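/- Let $\mathbb{K}$ be a field of characteristic $0$; all DG vector spaces are $\mathbb{Z}$-graded over $\mathbb{K}$ with differential of degree $+1$. Let $A$ be a differential graded associative algebra (not necessarily unital) and $M$ a left DG $A$-module. For a DG vector space $V$ put $V[t,dt]=V\otimes\mathbb{K}[t,dt]$ with $\deg t=0$, $\deg dt=1$ (so $V[t,dt]=V[t]\oplus V[t]dt$, $d(v\,p(t))=(dv)p(t)+(-1)^{\deg v}v\,p'(t)dt$ and $d(v\,q(t)dt)=(dv)q(t)dt$). Let $A\oplus M$ have the product $(a,m)(b,n)=(ab,an)$, and let $B(A,M)$ be the DG subalgebra of $(A\oplus M)[t,dt]=A[t,dt]\oplus M[t,dt]$ $$B(A,M)=\{(a(t),m(t))\in A[t,dt]\oplus M[t,dt]\mid a(0)=0,\ m(0)=m(1)=0\},$$ the product of $(A\oplus M)[t,dt]$ following the Koszul sign rule. As a graded vector space $B(A,M)=R_0\oplus R_1\oplus S_0\oplus S_1$, with $R_0=\{p\in A[t]\mid p(0)=0\}$, $R_1=A[t]dt$, $S_0=\{p\in M[t]\mid p(0)=p(1)=0\}$, $S_1=M[t]dt$. For $n\ge 1$ let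 $\int_n\colon\mathbb{K}[t]^{\otimes n}\to\mathbb{K}$ be the linear map $$\int_n p_1\otimes\cdots\otimes p_n=\int_{0\le t_1\le\cdots\le t_n\le 1}p_1(t_1)\cdots p_n(t_n)\,dt_1\cdots dt_n ,\qquad\text{i.e. } \int_n t^{a_1}\otimes\cdots\otimes t^{a_n}=\prod_{h=1}^n\frac{1}{h+\sum_{i=1}^h a_i}.$$ For a DG vector space $V$ and $k\in\mathbb{Z}$ let $V[k]^i=V^{k+i}$, with the same differential on the underlying space. For a DG algebra $B$ let $\overline{T}(B[1])=\bigoplus_{n\ge1}B[1]^{\otimes n}$ be the bar construction, with differential $Q$ the coderivation induced by $q_1=d$ and $q_2(b,c)=(-1)^{|b|}bc$, where $|b|$ is the degree of $b$ in $B[1]$. An $A_\infty$ morphism $B\to C$ of DG algebras is a linear map $F\colon\overline{T}(B[1])\to C[1]$ of degree $0$ such that, for all $n\geq 1$ and $b_1,\dots,b_n\in B$, $$F(Q(b_1\otimes\cdots\otimes b_n))=q_1F(b_1\otimes\cdots\otimes b_n)+\sum_{i=1}^{n-1}q_2\big(F(b_1\otimes\cdots\otimes b_i),F(b_{i+1}\otimes\cdots\otimes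 b_n)\big);$$ it is an $A_\infty$ quasi-isomorphism if its restriction $B[1]\to C[1]$ is a quasi-isomorphism of complexes. **Theorem.** Regard $M[-1]$ as a DG associative algebra with trivial product. There is a unique linear map $\int_\infty\colon\overline{T}(B(A,M)[1])\to M$ such that $$\int_\infty a_1q_1(t)dt\otimes\cdots\otimes a_nq_n(t)dt\otimes m\,p(t)dt=a_1\cdots a_n m\int_{n+1}q_1\otimes\cdots\otimes q_n\otimes p$$ for all $n\ge0$, $a_i\in A$, $m\in M$, $q_i,p\in\mathbb{K}[t]$, and which vanishes on all tensor products of the summands $R_0,R_1,S_0,S_1$ other than $R_1^{\otimes n}\otimes S_1$, $n\ge 0$. This map is an $A_\infty$ quasi-isomorphism $\int_\infty\colon B(A,M)\to M[-1]$. -/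

import Mathlib

open scoped TensorProduct Polynomial

noncomputable section

/-! Differential graded vector spaces over a field `K`: a `ℤ`-graded vector space
(internal grading, unbounded) with a differential of degree `+1`. -/

structure DGVec (K V : Type*) [Field K] [AddCommGroup V] [Module K V] where
  gr : ℤ → Submodule K V
  isInternal : DirectSum.IsInternal gr
  d : V →ₗ[K] V
  d_mem : ∀ (i : ℤ) (v : V), v ∈ gr i → d v ∈ gr (i + 1)
  d_d : ∀ v : V, d (d v) = 0

/-- A criterion for a family of submodules to be a grading: it spans, and there are
linear projections onto the members of the family. -/
theorem isInternal_of_proj {K V : Type*} [Field K] [AddCommGroup V] [Module K V]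
    (gr : ℤ → Submodule K V) (π : ℤ → V →ₗ[K] V)
    (h1 : ∀ i v, v ∈ gr i → π i v = v)
    (h2 : ∀ i j v, i ≠ j → v ∈ gr i → π j v = 0)
    (h3 : ⨆ i, gr i = ⊤) : DirectSum.IsInternal gr := by
  rw [DirectSum.isInternal_submodule_iff_iSupIndep_and_iSup_eq_top]
  refine ⟨?_, h3⟩
  rw [iSupIndep_def]
  intro i
  rw [Submodule.disjoint_def]
  intro x hx hx'
  have hle : (⨆ j, ⨆ (_ : j ≠ i), gr j) ≤ LinearMap.ker (π i) := by
    refine iSup_le fun j => iSup_le fun hj => ?_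
    intro v hv
    exact h2 j i v hj hv
  rw [← h1 i x hx]
  exact hle hx'

namespace DGVec

variable {K V W : Type*} [Field K] [AddCommGroup V] [Module K V]
  [AddCommGroup W] [Module K W]

/-- The isomorphism of `V` with the direct sum of its homogeneous pieces. -/
def decomp (C : DGVec K V) : V ≃ₗ[K] DirectSum ℤ (fun i => C.gr i) :=
  (LinearEquiv.ofBijective (DirectSum.coeLinearMap C.gr) C.isInternal).symm

/-- The homogeneous component of degree `i`. -/
def proj (C : DGVec K V) (i : ℤ) : V →ₗ[K] V :=
  (C.gr i).subtype ∘ₗ DirectSum.component K ℤ (fun i => C.gr i) i ∘ₗ C.decomp.toLinearMap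

/-- The sign operator: multiplication by `(-1) ^ i` on the piece of degree `i`. -/
def sgn (C : DGVec K V) : V →ₗ[K] V :=
  DirectSum.toModule K ℤ V (fun i => ((-1 : K) ^ i) • (C.gr i).subtype) ∘ₗ C.decomp.toLinearMap

theorem decomp_of_mem (C : DGVec K V) {i : ℤ} {v : V} (hv : v ∈ C.gr i) :
    C.decomp v = DirectSum.lof K ℤ (fun i => C.gr i) i ⟨v, hv⟩ := by
  refine (LinearEquiv.symm_apply_eq _).2 ?_
  exact (DirectSum.coeLinearMap_lof C.gr i ⟨v, hv⟩).symm

theorem proj_of_mem (C : DGVec K V) {i : ℤ} {v : V} (hv : v ∈ C.gr i) : C.proj i v = v := by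
  simp [proj, C.decomp_of_mem hv, DirectSum.component.lof_self]

theorem proj_of_mem_ne (C : DGVec K V) {i j : ℤ} (hij : i ≠ j) {v : V} (hv : v ∈ C.gr i) :
    C.proj j v = 0 := by
  simp [proj, C.decomp_of_mem hv, DirectSum.component.of, hij]

theorem proj_mem (C : DGVec K V) (i : ℤ) (v : V) : C.proj i v ∈ C.gr i := by
  simp [proj]

theorem sgn_of_mem (C : DGVec K V) {i : ℤ} {v : V} (hv : v ∈ C.gr i) :
    C.sgn v = ((-1 : K) ^ i) • v := by
  simp [sgn, C.decomp_of_mem hv, DirectSum.toModule_lof]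

theorem iSup_gr (C : DGVec K V) : ⨆ i, C.gr i = ⊤ :=
  C.isInternal.submodule_iSup_eq_top

/-- Linear maps agreeing on homogeneous elements are equal. -/
theorem hom_ext (C : DGVec K V) {f g : V →ₗ[K] W}
    (h : ∀ i v, v ∈ C.gr i → f v = g v) : f = g := by
  have : (⊤ : Submodule K V) ≤ LinearMap.eqLocus f g := by
    rw [← C.iSup_gr]
    exact iSup_le fun i v hv => h i v hv
  exact LinearMap.ext fun v => this trivial

theorem mem_span_proj (C : DGVec K V) (v : V) :
    ∃ s : Finset ℤ, v = ∑ i ∈ s, C.proj i v := by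
  classical
  have hv : v ∈ ⨆ i, C.gr i := by rw [C.iSup_gr]; trivial
  induction hv using Submodule.iSup_induction' with
  | mem i x hx => exact ⟨{i}, by simp [C.proj_of_mem hx]⟩
  | zero => exact ⟨∅, by simp⟩
  | add x y _ _ hx hy =>
    obtain ⟨s, hs⟩ := hx
    obtain ⟨t, ht⟩ := hy
    have key : ∀ (z : V) (s u : Finset ℤ), s ⊆ u → z = ∑ i ∈ s, C.proj i z →
        z = ∑ i ∈ u, C.proj i z := by
      intro z s u hsu hz
      rw [← Finset.sum_subset hsu]
      · exact hz
      · intro j _ hj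
        conv_lhs => rw [hz]
        rw [map_sum]
        refine Finset.sum_eq_zero fun i hi => ?_
        exact C.proj_of_mem_ne (fun h => hj (by rwa [← h])) (C.proj_mem i z)
    refine ⟨s ∪ t, ?_⟩
    have h1 := key x s (s ∪ t) Finset.subset_union_left hs
    have h2 := key y t (s ∪ t) Finset.subset_union_right ht
    simp only [map_add, Finset.sum_add_distrib]
    rw [← h1, ← h2]

theorem proj_eq (C : DGVec K V) (π : ℤ → V →ₗ[K] V)
    (h1 : ∀ i v, v ∈ C.gr i → π i v = v)
    (h2 : ∀ i j v, i ≠ j → v ∈ C.gr i → π j v = 0) (j : ℤ) : C.proj j = π j := by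
  refine C.hom_ext fun i v hv => ?_
  by_cases h : i = j
  · subst h; rw [C.proj_of_mem hv, h1 i v hv]
  · rw [C.proj_of_mem_ne h hv, h2 i j v h hv]

theorem sgn_mem (C : DGVec K V) {i : ℤ} {v : V} (hv : v ∈ C.gr i) : C.sgn v ∈ C.gr i := by
  rw [C.sgn_of_mem hv]; exact Submodule.smul_mem _ _ hv

theorem sgn_d (C : DGVec K V) (v : V) : C.sgn (C.d v) = -C.d (C.sgn v) := by
  have : C.sgn ∘ₗ C.d = -(C.d ∘ₗ C.sgn) := by
    refine C.hom_ext fun i v hv => ?_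
    simp only [LinearMap.comp_apply, LinearMap.neg_apply]
    rw [C.sgn_of_mem hv, C.sgn_of_mem (C.d_mem i v hv), map_smul,
      zpow_add₀ (by simp : (-1 : K) ≠ 0)]
    simp
  exact LinearMap.congr_fun this v

/-! ### Cohomology and quasi-isomorphisms -/

def cocycles (C : DGVec K V) (i : ℤ) : Submodule K V := C.gr i ⊓ LinearMap.ker C.d

def coboundaries (C : DGVec K V) (i : ℤ) : Submodule K V := (C.gr (i - 1)).map C.d

/-- The cohomology space `H^i`. -/
abbrev cohomology (C : DGVec K V) (i : ℤ) : Type _ :=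
  C.cocycles i ⧸ (C.coboundaries i).submoduleOf (C.cocycles i)

/-- Morphisms of DG vector spaces: linear maps of degree `0` commuting with differentials. -/
structure Hom (C : DGVec K V) (D : DGVec K W) where
  toLin : V →ₗ[K] W
  map_mem : ∀ (i : ℤ) (v : V), v ∈ C.gr i → toLin v ∈ D.gr i
  comm : ∀ v : V, toLin (C.d v) = D.d (toLin v)

theorem Hom.map_cocycles {C : DGVec K V} {D : DGVec K W} (f : Hom C D) (i : ℤ) :
    ∀ v ∈ C.cocycles i, f.toLin v ∈ D.cocycles i := by
  rintro v ⟨h1, h2⟩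
  refine ⟨f.map_mem i v h1, ?_⟩
  have h3 : C.d v = 0 := h2
  change D.d (f.toLin v) = 0
  rw [← f.comm, h3, map_zero]

/-- The map induced on `H^i`. -/
def Hom.cohomologyMap {C : DGVec K V} {D : DGVec K W} (f : Hom C D) (i : ℤ) :
    C.cohomology i →ₗ[K] D.cohomology i :=
  Submodule.mapQ _ _ (f.toLin.restrict (f.map_cocycles i)) (by
    rintro ⟨v, hv⟩ hv'
    obtain ⟨w, hw, hwv⟩ : v ∈ C.coboundaries i := hv'
    change f.toLin v ∈ D.coboundaries i
    exact ⟨f.toLin w, f.map_mem _ _ hw, by rw [← f.comm, hwv]⟩)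

/-- A quasi-isomorphism: a morphism of DG vector spaces inducing isomorphisms in cohomology. -/
def IsQuasiIso (C : DGVec K V) (D : DGVec K W) (f : V →ₗ[K] W) : Prop :=
  ∃ φ : Hom C D, φ.toLin = f ∧ ∀ i : ℤ, Function.Bijective (φ.cohomologyMap i)

/-! ### Constructions -/

/-- The shift `V[n]`, with `V[n]^i = V^(n+i)` and the same differential on the underlying
space. -/
def shift (C : DGVec K V) (n : ℤ) : DGVec K V where
  gr i := C.gr (n + i)
  isInternal := by
    refine isInternal_of_proj _ (fun i => C.proj (n + i)) (fun i v hv => C.proj_of_mem hv)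
      (fun i j v hij hv => C.proj_of_mem_ne (by omega) hv) ?_
    rw [← C.iSup_gr]
    exact (Equiv.addLeft n).iSup_congr fun i => rfl
  d := C.d
  d_mem i v hv := by
    have := C.d_mem _ v hv
    rwa [add_assoc] at this
  d_d := C.d_d

/-- The direct sum of two DG vector spaces. -/
def prod (C : DGVec K V) (D : DGVec K W) : DGVec K (V × W) where
  gr i := (C.gr i).prod (D.gr i)
  isInternal := by
    refine isInternal_of_proj _ (fun i => (C.proj i).prodMap (D.proj i)) ?_ ?_ ?_
    · rintro i ⟨v, w⟩ ⟨hv, hw⟩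
      simp [C.proj_of_mem hv, D.proj_of_mem hw]
    · rintro i j ⟨v, w⟩ hij ⟨hv, hw⟩
      simp [C.proj_of_mem_ne hij hv, D.proj_of_mem_ne hij hw]
    · rw [eq_top_iff]
      rintro ⟨v, w⟩ -
      have h1 : (⨆ i, C.gr i) ≤ (⨆ i, (C.gr i).prod (D.gr i)).comap (LinearMap.inl K V W) :=
        iSup_le fun i v hv => Submodule.mem_iSup_of_mem i ⟨hv, Submodule.zero_mem _⟩
      have h2 : (⨆ i, D.gr i) ≤ (⨆ i, (C.gr i).prod (D.gr i)).comap (LinearMap.inr K V W) :=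
        iSup_le fun i v hv => Submodule.mem_iSup_of_mem i ⟨Submodule.zero_mem _, hv⟩
      have e : ((v, w) : V × W) = LinearMap.inl K V W v + LinearMap.inr K V W w := by simp
      rw [e]
      refine Submodule.add_mem _ (h1 ?_) (h2 ?_)
      · rw [C.iSup_gr]; trivial
      · rw [D.iSup_gr]; trivial
  d := C.d.prodMap D.d
  d_mem := by
    rintro i ⟨v, w⟩ ⟨hv, hw⟩
    exact ⟨C.d_mem i v hv, D.d_mem i w hw⟩
  d_d := by
    rintro ⟨v, w⟩
    simp [C.d_d, D.d_d]

/-- A subcomplex: a linear subspace stable under the differential and under taking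
homogeneous components. -/
def sub (C : DGVec K V) (S : Submodule K V) (hd : ∀ v ∈ S, C.d v ∈ S)
    (hp : ∀ (i : ℤ), ∀ v ∈ S, C.proj i v ∈ S) : DGVec K S where
  gr i := (C.gr i).comap S.subtype
  isInternal := by
    refine isInternal_of_proj _ (fun i => (C.proj i).restrict (hp i)) ?_ ?_ ?_
    · rintro i ⟨v, hv⟩ h
      exact Subtype.ext (C.proj_of_mem h)
    · rintro i j ⟨v, hv⟩ hij h
      exact Subtype.ext (C.proj_of_mem_ne hij h)
    · rw [eq_top_iff]
      rintro ⟨v, hv⟩ -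
      obtain ⟨s, hs⟩ := C.mem_span_proj v
      have e : (⟨v, hv⟩ : S) = ∑ i ∈ s, (⟨C.proj i v, hp i v hv⟩ : S) := by
        apply Subtype.ext
        simpa using hs
      rw [e]
      exact Submodule.sum_mem _ fun i _ => Submodule.mem_iSup_of_mem i (C.proj_mem i v)
  d := C.d.restrict hd
  d_mem i v hv := C.d_mem i v hv
  d_d v := Subtype.ext (C.d_d v)

/-- The underlying space of `V[t,dt] = V[t] ⊕ V[t]dt`, where `V[t] = V ⊗ K[t]`.
The pair `(p, q)` stands for `p(t) + q(t)dt`. -/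
abbrev Forms (K V : Type*) [Field K] [AddCommGroup V] [Module K V] : Type _ :=
  (V ⊗[K] K[X]) × (V ⊗[K] K[X])

/-- The polynomials `v p(t)` with coefficients in degree `i`. -/
def polyGr (C : DGVec K V) (i : ℤ) : Submodule K (V ⊗[K] K[X]) :=
  LinearMap.range (LinearMap.rTensor K[X] (C.gr i).subtype)

theorem map_polyGr (C : DGVec K V) (D : DGVec K W) {i j : ℤ} (f : V →ₗ[K] W)
    (g : K[X] →ₗ[K] K[X]) (hf : ∀ v ∈ C.gr i, f v ∈ D.gr j) {x : V ⊗[K] K[X]}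
    (hx : x ∈ C.polyGr i) : TensorProduct.map f g x ∈ D.polyGr j := by
  obtain ⟨y, rfl⟩ := hx
  induction y using TensorProduct.induction_on with
  | zero => simp
  | tmul v p => exact ⟨⟨f v, hf v v.2⟩ ⊗ₜ g p, by simp⟩
  | add x y hx hy => simp only [map_add]; exact Submodule.add_mem _ hx hy

theorem polyGr_map_eq (C : DGVec K V) {i : ℤ} (f g : V →ₗ[K] W)
    (h : ∀ v ∈ C.gr i, f v = g v) {x : V ⊗[K] K[X]} (hx : x ∈ C.polyGr i) :
    LinearMap.rTensor K[X] f x = LinearMap.rTensor K[X] g x := by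
  obtain ⟨y, rfl⟩ := hx
  induction y using TensorProduct.induction_on with
  | zero => simp
  | tmul v p => simp [h v v.2]
  | add x y hx hy => simp only [map_add, hx, hy]

theorem iSup_polyGr (C : DGVec K V) : ⨆ i, C.polyGr i = ⊤ := by
  rw [eq_top_iff]
  rintro x -
  induction x using TensorProduct.induction_on with
  | zero => exact Submodule.zero_mem _
  | tmul v p =>
    have h : (⨆ i, C.gr i) ≤ (⨆ i, C.polyGr i).comap
        ((TensorProduct.mk K V K[X]).flip p) := by
      refine iSup_le fun i v hv => Submodule.mem_iSup_of_mem i ?_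
      exact ⟨(⟨v, hv⟩ : C.gr i) ⊗ₜ p, by simp⟩
    exact h (by rw [C.iSup_gr]; trivial)
  | add x y hx hy => exact Submodule.add_mem _ hx hy

/-- The homogeneous components in `V[t,dt]`. -/
def formsProj (C : DGVec K V) (i : ℤ) : Forms K V →ₗ[K] Forms K V :=
  (LinearMap.rTensor K[X] (C.proj i)).prodMap (LinearMap.rTensor K[X] (C.proj (i - 1)))

/-- The sign operator on `V[t]`, given by the degree of the coefficients. -/
def polySgn (C : DGVec K V) : V ⊗[K] K[X] →ₗ[K] V ⊗[K] K[X] :=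
  LinearMap.rTensor K[X] C.sgn

/-- The differential of `V[t,dt]`:
`d (v p(t)) = (dv) p(t) + (-1)^i v p'(t) dt` and `d (v q(t)dt) = (dv) q(t)dt`
for `v` of degree `i`. -/
def formsD (C : DGVec K V) : Forms K V →ₗ[K] Forms K V :=
  LinearMap.prod (LinearMap.rTensor K[X] C.d ∘ₗ LinearMap.fst K _ _)
    (TensorProduct.map C.sgn (Polynomial.derivative (R := K)) ∘ₗ LinearMap.fst K _ _ +
      LinearMap.rTensor K[X] C.d ∘ₗ LinearMap.snd K _ _)

theorem formsProj_of_mem (C : DGVec K V) (i : ℤ) (v : Forms K V)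
    (hv : v ∈ (C.polyGr i).prod (C.polyGr (i - 1))) : C.formsProj i v = v := by
  refine Prod.ext ?_ ?_
  · have := C.polyGr_map_eq (C.proj i) LinearMap.id (fun v hv => C.proj_of_mem hv) hv.1
    simpa [formsProj] using this
  · have := C.polyGr_map_eq (C.proj (i - 1)) LinearMap.id (fun v hv => C.proj_of_mem hv) hv.2
    simpa [formsProj] using this

theorem formsProj_of_mem_ne (C : DGVec K V) (i j : ℤ) (v : Forms K V) (hij : i ≠ j)
    (hv : v ∈ (C.polyGr i).prod (C.polyGr (i - 1))) : C.formsProj j v = 0 := by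
  refine Prod.ext ?_ ?_
  · have := C.polyGr_map_eq (C.proj j) 0 (fun v hv => C.proj_of_mem_ne hij hv) hv.1
    simpa [formsProj] using this
  · have := C.polyGr_map_eq (C.proj (j - 1)) 0
      (fun v hv => C.proj_of_mem_ne (by omega) hv) hv.2
    simpa [formsProj] using this

/-- The DG vector space `V[t,dt] = V ⊗ K[t,dt]`, with `t` of degree `0` and `dt` of
degree `1`. -/
def forms (C : DGVec K V) : DGVec K (Forms K V) where
  gr i := (C.polyGr i).prod (C.polyGr (i - 1))
  isInternal := by
    refine isInternal_of_proj _ C.formsProj C.formsProj_of_mem C.formsProj_of_mem_ne ?_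
    rw [eq_top_iff]
    rintro ⟨v, w⟩ -
    have h1 : (⨆ i, C.polyGr i) ≤ (⨆ i, (C.polyGr i).prod (C.polyGr (i - 1))).comap
        (LinearMap.inl K _ _) :=
      iSup_le fun i v hv => Submodule.mem_iSup_of_mem i ⟨hv, Submodule.zero_mem _⟩
    have h2 : (⨆ i, C.polyGr i) ≤ (⨆ i, (C.polyGr i).prod (C.polyGr (i - 1))).comap
        (LinearMap.inr K _ _) :=
      iSup_le fun i v hv => Submodule.mem_iSup_of_mem (i + 1)
        ⟨Submodule.zero_mem _, by simpa using hv⟩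
    have e : ((v, w) : Forms K V) = LinearMap.inl K _ _ v + LinearMap.inr K _ _ w := by simp
    rw [e]
    refine Submodule.add_mem _ (h1 ?_) (h2 ?_) <;>
    · rw [C.iSup_polyGr]; trivial
  d := C.formsD
  d_mem := by
    rintro i ⟨p, q⟩ ⟨hp, hq⟩
    refine ⟨C.map_polyGr C C.d LinearMap.id (C.d_mem i) hp, ?_⟩
    refine Submodule.add_mem _ ?_ ?_
    · have := C.map_polyGr C (j := i) C.sgn (Polynomial.derivative (R := K))
        (fun v hv => C.sgn_mem hv) hp
      simpa using this
    · refine C.map_polyGr C C.d LinearMap.id (fun v hv => ?_) hq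
      have := C.d_mem _ v hv
      rwa [show i - 1 + 1 = i + 1 - 1 by ring] at this
  d_d := by
    have hdd : C.d ∘ₗ C.d = 0 := LinearMap.ext C.d_d
    rintro ⟨p, q⟩
    have hp : LinearMap.rTensor K[X] C.d (LinearMap.rTensor K[X] C.d p) = 0 := by
      rw [← LinearMap.comp_apply, ← LinearMap.rTensor_comp, hdd]; simp
    have hq : LinearMap.rTensor K[X] C.d (LinearMap.rTensor K[X] C.d q) = 0 := by
      rw [← LinearMap.comp_apply, ← LinearMap.rTensor_comp, hdd]; simp
    have hm : TensorProduct.map C.sgn (Polynomial.derivative (R := K))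
          (LinearMap.rTensor K[X] C.d p) +
        LinearMap.rTensor K[X] C.d
          (TensorProduct.map C.sgn (Polynomial.derivative (R := K)) p) = 0 := by
      clear hp hq
      induction p using TensorProduct.induction_on with
      | zero => simp
      | tmul v p => simp [C.sgn_d, TensorProduct.neg_tmul]
      | add x y hx hy =>
        simp only [map_add]
        rw [add_add_add_comm, hx, hy, add_zero]
    refine Prod.ext ?_ ?_
    · simpa [formsD] using hp
    · change TensorProduct.map C.sgn (Polynomial.derivative (R := K))
          (LinearMap.rTensor K[X] C.d p) + LinearMap.rTensor K[X] C.d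
          (TensorProduct.map C.sgn (Polynomial.derivative (R := K)) p +
            LinearMap.rTensor K[X] C.d q) = 0
      rw [map_add, hq, add_zero]
      exact hm

theorem forms_proj (C : DGVec K V) (i : ℤ) : C.forms.proj i = C.formsProj i :=
  C.forms.proj_eq C.formsProj C.formsProj_of_mem C.formsProj_of_mem_ne i

/-- Evaluation of a polynomial with coefficients in `V` at `t = c`. -/
def polyEval (K V : Type*) [Field K] [AddCommGroup V] [Module K V] (c : K) :
    V ⊗[K] K[X] →ₗ[K] V :=
  (TensorProduct.rid K V).toLinearMap ∘ₗ LinearMap.lTensor V (Polynomial.leval c)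

@[simp]
theorem polyEval_tmul (c : K) (v : V) (p : K[X]) :
    polyEval K V c (v ⊗ₜ p) = p.eval c • v := by
  simp [polyEval, Polynomial.leval]

theorem polyEval_rTensor (c : K) (f : V →ₗ[K] W) (x : V ⊗[K] K[X]) :
    polyEval K W c (LinearMap.rTensor K[X] f x) = f (polyEval K V c x) := by
  induction x using TensorProduct.induction_on with
  | zero => simp
  | tmul v p => simp
  | add x y hx hy => simp only [map_add, hx, hy]

end DGVec

/-! Differential graded associative algebras (not necessarily unital) and their left modules. -/

structure DGAlg (K A : Type*) [Field K] [AddCommGroup A] [Module K A] extends DGVec K A where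
  mul : A →ₗ[K] A →ₗ[K] A
  mul_mem : ∀ (i j : ℤ) (a b : A), a ∈ gr i → b ∈ gr j → mul a b ∈ gr (i + j)
  mul_assoc : ∀ a b c : A, mul (mul a b) c = mul a (mul b c)
  leibniz : ∀ (i : ℤ) (a b : A), a ∈ gr i →
    d (mul a b) = mul (d a) b + ((-1 : K) ^ i) • mul a (d b)

structure DGMod {K A : Type*} [Field K] [AddCommGroup A] [Module K A] (R : DGAlg K A)
    (M : Type*) [AddCommGroup M] [Module K M] extends DGVec K M where
  act : A →ₗ[K] M →ₗ[K] M
  act_mem : ∀ (i j : ℤ) (a : A) (m : M), a ∈ R.gr i → m ∈ gr j → act a m ∈ gr (i + j)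
  mul_act : ∀ (a b : A) (m : M), act (R.mul a b) m = act a (act b m)
  leibniz : ∀ (i : ℤ) (a : A) (m : M), a ∈ R.gr i →
    d (act a m) = act (R.d a) m + ((-1 : K) ^ i) • act a (d m)

namespace DGAlg

variable {K A M : Type*} [Field K] [AddCommGroup A] [Module K A] [AddCommGroup M] [Module K M]

theorem sgn_mul (R : DGAlg K A) (a b : A) :
    R.sgn (R.mul a b) = R.mul (R.sgn a) (R.sgn b) := by
  have : R.mul.compr₂ R.sgn = R.mul.compl₁₂ R.sgn R.sgn := by
    refine R.hom_ext fun i a ha => R.hom_ext fun j b hb => ?_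
    simp only [LinearMap.compr₂_apply, LinearMap.compl₁₂_apply]
    rw [R.sgn_of_mem (R.mul_mem i j a b ha hb), R.sgn_of_mem ha, R.sgn_of_mem hb,
      zpow_add₀ (by simp : (-1 : K) ≠ 0)]
    simp [smul_smul, mul_comm]
  exact LinearMap.congr_fun₂ this a b

theorem leibniz_sgn (R : DGAlg K A) (a b : A) :
    R.d (R.mul a b) = R.mul (R.d a) b + R.mul (R.sgn a) (R.d b) := by
  have : R.mul.compr₂ R.d = R.mul.comp R.d + R.mul.compl₁₂ R.sgn R.d := by
    refine R.hom_ext fun i a ha => LinearMap.ext fun b => ?_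
    simp only [LinearMap.compr₂_apply, LinearMap.compl₁₂_apply, LinearMap.add_apply,
      LinearMap.comp_apply]
    rw [R.leibniz i a b ha, R.sgn_of_mem ha, map_smul, LinearMap.smul_apply]
  exact LinearMap.congr_fun₂ this a b

/-- A DG vector space as a DG algebra with trivial product. -/
def trivial (C : DGVec K A) : DGAlg K A where
  toDGVec := C
  mul := 0
  mul_mem i j a b _ _ := by simp
  mul_assoc a b c := by simp
  leibniz i a b _ := by simp

/-- The DG algebra `A ⊕ M` with product `(a, m) (b, n) = (a b, a n)`. -/
def semidirect (R : DGAlg K A) (N : DGMod R M) : DGAlg K (A × M) where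
  toDGVec := R.toDGVec.prod N.toDGVec
  mul := LinearMap.mk₂ K (fun x y => (R.mul x.1 y.1, N.act x.1 y.2))
    (by intros; simp) (by intros; simp) (by intros; simp) (by intros; simp)
  mul_mem := by
    rintro i j ⟨a, m⟩ ⟨b, n⟩ ⟨ha, hm⟩ ⟨hb, hn⟩
    exact ⟨R.mul_mem i j a b ha hb, N.act_mem i j a n ha hn⟩
  mul_assoc := by
    rintro ⟨a, m⟩ ⟨b, n⟩ ⟨c, o⟩
    exact Prod.ext (R.mul_assoc a b c) (N.mul_act a b o)
  leibniz := by
    rintro i ⟨a, m⟩ ⟨b, n⟩ ⟨ha, hm⟩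
    exact Prod.ext (R.leibniz i a b ha) (N.leibniz i a n ha)

/-- A DG subalgebra. -/
def sub (R : DGAlg K A) (S : Submodule K A) (hd : ∀ v ∈ S, R.d v ∈ S)
    (hp : ∀ (i : ℤ), ∀ v ∈ S, R.proj i v ∈ S) (hm : ∀ v ∈ S, ∀ w ∈ S, R.mul v w ∈ S) :
    DGAlg K S where
  toDGVec := R.toDGVec.sub S hd hp
  mul := LinearMap.mk₂ K (fun v w => ⟨R.mul v w, hm v v.2 w w.2⟩)
    (by intros; apply Subtype.ext; simp) (by intros; apply Subtype.ext; simp)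
    (by intros; apply Subtype.ext; simp) (by intros; apply Subtype.ext; simp)
  mul_mem i j a b ha hb := R.mul_mem i j a b ha hb
  mul_assoc a b c := Subtype.ext (R.mul_assoc a b c)
  leibniz i a b ha := Subtype.ext (R.leibniz i a b ha)

/-! ### The DG algebra `A[t,dt]` -/

/-- The product of `A[t]`: `(a p(t)) (b q(t)) = (a b) p(t) q(t)`. -/
def polyMul (R : DGAlg K A) : A ⊗[K] K[X] →ₗ[K] A ⊗[K] K[X] →ₗ[K] A ⊗[K] K[X] :=
  TensorProduct.map₂ R.mul (LinearMap.mul K K[X])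

@[simp]
theorem polyMul_tmul (R : DGAlg K A) (a b : A) (p q : K[X]) :
    R.polyMul (a ⊗ₜ p) (b ⊗ₜ q) = R.mul a b ⊗ₜ (p * q) := by
  simp [polyMul]

theorem polyMul_assoc (R : DGAlg K A) (x y z : A ⊗[K] K[X]) :
    R.polyMul (R.polyMul x y) z = R.polyMul x (R.polyMul y z) := by
  induction x using TensorProduct.induction_on with
  | zero => simp
  | add x x' hx hx' => simp only [map_add, LinearMap.add_apply, hx, hx']
  | tmul a p =>
    induction y using TensorProduct.induction_on with
    | zero => simp
    | add y y' hy hy' => simp only [map_add, LinearMap.add_apply, hy, hy']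
    | tmul b q =>
      induction z using TensorProduct.induction_on with
      | zero => simp
      | add z z' hz hz' => simp only [map_add, hz, hz']
      | tmul c r => simp [R.mul_assoc, _root_.mul_assoc]

theorem polySgn_polyMul (R : DGAlg K A) (x y : A ⊗[K] K[X]) :
    R.polySgn (R.polyMul x y) = R.polyMul (R.polySgn x) (R.polySgn y) := by
  unfold DGVec.polySgn
  induction x using TensorProduct.induction_on with
  | zero => simp
  | add x x' hx hx' => simp only [map_add, LinearMap.add_apply, hx, hx']
  | tmul a p =>
    induction y using TensorProduct.induction_on with
    | zero => simp
    | add y y' hy hy' => simp only [map_add, hy, hy']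
    | tmul b q => simp [R.sgn_mul]

theorem polyD_polyMul (R : DGAlg K A) (x y : A ⊗[K] K[X]) :
    LinearMap.rTensor K[X] R.d (R.polyMul x y) =
      R.polyMul (LinearMap.rTensor K[X] R.d x) y +
        R.polyMul (R.polySgn x) (LinearMap.rTensor K[X] R.d y) := by
  unfold DGVec.polySgn
  induction x using TensorProduct.induction_on with
  | zero => simp
  | add x x' hx hx' => simp only [map_add, LinearMap.add_apply, hx, hx']; abel
  | tmul a p =>
    induction y using TensorProduct.induction_on with
    | zero => simp
    | add y y' hy hy' => simp only [map_add, hy, hy']; abel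
    | tmul b q => simp [R.leibniz_sgn, TensorProduct.add_tmul]

theorem polyDer_polyMul (R : DGAlg K A) (x y : A ⊗[K] K[X]) :
    TensorProduct.map R.sgn (Polynomial.derivative (R := K)) (R.polyMul x y) =
      R.polyMul (TensorProduct.map R.sgn (Polynomial.derivative (R := K)) x) (R.polySgn y) +
        R.polyMul (R.polySgn x)
          (TensorProduct.map R.sgn (Polynomial.derivative (R := K)) y) := by
  unfold DGVec.polySgn
  induction x using TensorProduct.induction_on with
  | zero => simp
  | add x x' hx hx' => simp only [map_add, LinearMap.add_apply, hx, hx']; abel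
  | tmul a p =>
    induction y using TensorProduct.induction_on with
    | zero => simp
    | add y y' hy hy' => simp only [map_add, hy, hy']; abel
    | tmul b q => simp [R.sgn_mul, Polynomial.derivative_mul, TensorProduct.tmul_add]

theorem polySgn_polySgn (C : DGVec K A) (x : A ⊗[K] K[X]) : C.polySgn (C.polySgn x) = x := by
  have h : C.sgn ∘ₗ C.sgn = LinearMap.id := by
    refine C.hom_ext fun i v hv => ?_
    rw [LinearMap.comp_apply, C.sgn_of_mem hv, map_smul, C.sgn_of_mem hv, smul_smul,
      ← zpow_add₀ (by simp : (-1 : K) ≠ 0), Even.neg_one_zpow ⟨i, rfl⟩]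
    simp
  unfold DGVec.polySgn
  rw [← LinearMap.comp_apply, ← LinearMap.rTensor_comp, h]
  simp

theorem polySgn_polyD (C : DGVec K A) (x : A ⊗[K] K[X]) :
    C.polySgn (LinearMap.rTensor K[X] C.d x) = -LinearMap.rTensor K[X] C.d (C.polySgn x) := by
  unfold DGVec.polySgn
  induction x using TensorProduct.induction_on with
  | zero => simp
  | add x x' hx hx' => simp only [map_add, hx, hx', neg_add]
  | tmul a p => simp [C.sgn_d, TensorProduct.neg_tmul]

theorem polySgn_of_mem (C : DGVec K A) {i : ℤ} {x : A ⊗[K] K[X]} (hx : x ∈ C.polyGr i) :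
    C.polySgn x = ((-1 : K) ^ i) • x := by
  have := C.polyGr_map_eq C.sgn (((-1 : K) ^ i) • LinearMap.id)
    (fun v hv => by simpa using C.sgn_of_mem hv) hx
  unfold DGVec.polySgn
  simpa [LinearMap.rTensor_smul] using this

theorem polyMul_mem (R : DGAlg K A) {i j : ℤ} {x y : A ⊗[K] K[X]} (hx : x ∈ R.polyGr i)
    (hy : y ∈ R.polyGr j) : R.polyMul x y ∈ R.polyGr (i + j) := by
  obtain ⟨x, rfl⟩ := hx
  obtain ⟨y, rfl⟩ := hy
  induction x using TensorProduct.induction_on with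
  | zero => simp
  | add x x' hx hx' =>
    simp only [map_add, LinearMap.add_apply]; exact Submodule.add_mem _ hx hx'
  | tmul a p =>
    induction y using TensorProduct.induction_on with
    | zero => simp
    | add y y' hy hy' => simp only [map_add]; exact Submodule.add_mem _ hy hy'
    | tmul b q =>
      exact ⟨⟨R.mul a b, R.mul_mem i j a b a.2 b.2⟩ ⊗ₜ (p * q), by simp⟩

/-- The product of `A[t,dt]`:
`(p + q dt) (p' + q' dt) = p p' + (p q' + q ε(p')) dt`, where `ε` is the sign coming from
moving `dt` across the coefficients of `p'`. -/
def formsMul (R : DGAlg K A) :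
    DGVec.Forms K A →ₗ[K] DGVec.Forms K A →ₗ[K] DGVec.Forms K A :=
  LinearMap.mk₂ K
    (fun x y => (R.polyMul x.1 y.1, R.polyMul x.1 y.2 + R.polyMul x.2 (R.polySgn y.1)))
    (by intros; ext1 <;> simp; abel) (by intros; ext1 <;> simp)
    (by intros; ext1 <;> simp; abel) (by intros; ext1 <;> simp)

/-- The DG algebra `A[t,dt] = A ⊗ K[t,dt]`. -/
def forms (R : DGAlg K A) : DGAlg K (DGVec.Forms K A) where
  toDGVec := R.toDGVec.forms
  mul := R.formsMul
  mul_mem := by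
    rintro i j ⟨p, q⟩ ⟨p', q'⟩ ⟨hp, hq⟩ ⟨hp', hq'⟩
    refine ⟨R.polyMul_mem hp hp', Submodule.add_mem _ ?_ ?_⟩
    · have := R.polyMul_mem hp hq'
      rwa [show i + (j - 1) = i + j - 1 by ring] at this
    · have h : R.polySgn p' ∈ R.polyGr j := by
        rw [polySgn_of_mem R.toDGVec hp']; exact Submodule.smul_mem _ _ hp'
      have := R.polyMul_mem hq h
      rwa [show i - 1 + j = i + j - 1 by ring] at this
  mul_assoc := by
    rintro ⟨p, q⟩ ⟨p', q'⟩ ⟨p'', q''⟩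
    refine Prod.ext ?_ ?_
    · exact R.polyMul_assoc p p' p''
    · change R.polyMul (R.polyMul p p') q'' +
          R.polyMul (R.polyMul p q' + R.polyMul q (R.polySgn p')) (R.polySgn p'') =
        R.polyMul p (R.polyMul p' q'' + R.polyMul q' (R.polySgn p'')) +
          R.polyMul q (R.polySgn (R.polyMul p' p''))
      simp only [map_add, LinearMap.add_apply, R.polyMul_assoc, R.polySgn_polyMul]
      abel
  leibniz := by
    rintro i ⟨p, q⟩ ⟨p', q'⟩ ⟨hp, hq⟩
    have hp1 := polySgn_of_mem R.toDGVec hp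
    have hq1 := polySgn_of_mem R.toDGVec hq
    have hi : ((-1 : K) ^ (i - 1)) = -((-1 : K) ^ i) := by
      rw [zpow_sub₀ (by simp : (-1 : K) ≠ 0), zpow_one, div_neg, div_one]
    refine Prod.ext ?_ ?_
    · change LinearMap.rTensor K[X] R.d (R.polyMul p p') =
        R.polyMul (LinearMap.rTensor K[X] R.d p) p' +
          ((-1 : K) ^ i) • R.polyMul p (LinearMap.rTensor K[X] R.d p')
      rw [R.polyD_polyMul, hp1]; simp
    · change TensorProduct.map R.sgn (Polynomial.derivative (R := K)) (R.polyMul p p') +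
          LinearMap.rTensor K[X] R.d (R.polyMul p q' + R.polyMul q (R.polySgn p')) =
        (R.polyMul (LinearMap.rTensor K[X] R.d p) q' +
          R.polyMul (TensorProduct.map R.sgn (Polynomial.derivative (R := K)) p +
            LinearMap.rTensor K[X] R.d q) (R.polySgn p')) +
        ((-1 : K) ^ i) • (R.polyMul p
            (TensorProduct.map R.sgn (Polynomial.derivative (R := K)) p' +
              LinearMap.rTensor K[X] R.d q') +
          R.polyMul q (R.polySgn (LinearMap.rTensor K[X] R.d p')))
      rw [R.polyDer_polyMul, map_add, R.polyD_polyMul, R.polyD_polyMul, polySgn_polyD,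
        hp1, hq1, hi]
      simp only [map_add, map_smul, map_neg, LinearMap.add_apply, LinearMap.smul_apply,
        smul_add, smul_neg, neg_smul, LinearMap.neg_apply]
      abel

theorem polyEval_polyMul (R : DGAlg K A) (c : K) (x y : A ⊗[K] K[X]) :
    DGVec.polyEval K A c (R.polyMul x y) =
      R.mul (DGVec.polyEval K A c x) (DGVec.polyEval K A c y) := by
  induction x using TensorProduct.induction_on with
  | zero => simp
  | add x x' hx hx' => simp only [map_add, LinearMap.add_apply, hx, hx']
  | tmul a p =>
    induction y using TensorProduct.induction_on with
    | zero => simp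
    | add y y' hy hy' => simp only [map_add, hy, hy']
    | tmul b q => simp [smul_smul, mul_comm]

end DGAlg

/-! ### The Thom-Whitney fibre algebra `B(A,M)` -/

/-- The space of those `x = (a, m)` in `(A ⊕ M)[t,dt] = A[t,dt] ⊕ M[t,dt]` with
`a(0) = 0` and `m(0) = m(1) = 0`. -/
def fiberSub (K A M : Type*) [Field K] [AddCommGroup A] [Module K A] [AddCommGroup M]
    [Module K M] : Submodule K (DGVec.Forms K (A × M)) where
  carrier := {x | (DGVec.polyEval K (A × M) 0 x.1).1 = 0 ∧
    (DGVec.polyEval K (A × M) 0 x.1).2 = 0 ∧ (DGVec.polyEval K (A × M) 1 x.1).2 = 0}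
  zero_mem' := by simp
  add_mem' := by
    rintro x y ⟨h1, h2, h3⟩ ⟨h1', h2', h3'⟩
    refine ⟨?_, ?_, ?_⟩ <;> simp [*]
  smul_mem' := by
    rintro c x ⟨h1, h2, h3⟩
    refine ⟨?_, ?_, ?_⟩ <;> simp [*]

/-- The DG algebra `B(A,M)`. -/
def fiberAlg {K A M : Type*} [Field K] [AddCommGroup A] [Module K A] [AddCommGroup M]
    [Module K M] (R : DGAlg K A) (N : DGMod R M) : DGAlg K (fiberSub K A M) :=
  (R.semidirect N).forms.sub (fiberSub K A M)
    (by
      rintro ⟨p, q⟩ ⟨h1, h2, h3⟩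
      have key : ∀ c : K, DGVec.polyEval K (A × M) c
          (((R.semidirect N).forms.d (p, q)).1) =
          (R.semidirect N).d (DGVec.polyEval K (A × M) c p) :=
        fun c => DGVec.polyEval_rTensor c _ p
      refine ⟨?_, ?_, ?_⟩
      · rw [key]
        exact (congrArg R.d h1).trans (map_zero _)
      · rw [key]
        exact (congrArg N.d h2).trans (map_zero _)
      · rw [key]
        exact (congrArg N.d h3).trans (map_zero _))
    (by
      rintro i ⟨p, q⟩ ⟨h1, h2, h3⟩
      have key : ∀ c : K, DGVec.polyEval K (A × M) c
          (((R.semidirect N).forms.proj i (p, q)).1) =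
          (R.toDGVec.proj i (DGVec.polyEval K (A × M) c p).1,
            N.toDGVec.proj i (DGVec.polyEval K (A × M) c p).2) := by
        intro c
        have e1 : (R.semidirect N).forms.proj i =
          (R.semidirect N).toDGVec.formsProj i := DGVec.forms_proj _ i
        have e2 : (R.semidirect N).toDGVec.proj i =
            (R.toDGVec.proj i).prodMap (N.toDGVec.proj i) := by
          refine DGVec.proj_eq _ (fun i => (R.toDGVec.proj i).prodMap (N.toDGVec.proj i))
            ?_ ?_ i
          · rintro i ⟨v, w⟩ ⟨hv, hw⟩
            simp [R.proj_of_mem hv, N.proj_of_mem hw]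
          · rintro i j ⟨v, w⟩ hij ⟨hv, hw⟩
            simp [R.proj_of_mem_ne hij hv, N.proj_of_mem_ne hij hw]
        rw [e1]
        refine (DGVec.polyEval_rTensor c _ p).trans ?_
        rw [e2]; rfl
      refine ⟨?_, ?_, ?_⟩
      · rw [key]
        change R.proj i _ = 0
        rw [h1, map_zero]
      · rw [key]
        change N.proj i _ = 0
        rw [h2, map_zero]
      · rw [key]
        change N.proj i _ = 0
        rw [h3, map_zero])
    (by
      rintro ⟨p, q⟩ ⟨h1, h2, h3⟩ ⟨p', q'⟩ ⟨h1', h2', h3'⟩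
      have key : ∀ c : K, DGVec.polyEval K (A × M) c
          (((R.semidirect N).forms.mul (p, q) (p', q')).1) =
          (R.mul (DGVec.polyEval K (A × M) c p).1 (DGVec.polyEval K (A × M) c p').1,
            N.act (DGVec.polyEval K (A × M) c p).1 (DGVec.polyEval K (A × M) c p').2) :=
        fun c => (R.semidirect N).polyEval_polyMul c p p'
      refine ⟨?_, ?_, ?_⟩
      · rw [key]
        change R.mul _ _ = 0
        rw [h1', map_zero]
      · rw [key]
        change N.act _ _ = 0
        rw [h2', map_zero]
      · rw [key]
        change N.act _ _ = 0
        rw [h3', map_zero])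

/-! The four summands of `B(A,M) = R₀ ⊕ R₁ ⊕ S₀ ⊕ S₁`. -/

inductive FiberPart
  | R0
  | R1
  | S0
  | S1

/-- `R₀`: polynomials in `A[t]`; `R₁ = A[t]dt`; `S₀`: polynomials in `M[t]`;
`S₁ = M[t]dt`; always inside `B(A,M)`. -/
def fiberPart (K A M : Type*) [Field K] [AddCommGroup A] [Module K A] [AddCommGroup M]
    [Module K M] : FiberPart → Set (fiberSub K A M)
  | .R0 => {b | b.1.2 = 0 ∧ LinearMap.rTensor K[X] (LinearMap.snd K A M) b.1.1 = 0}
  | .R1 => {b | b.1.1 = 0 ∧ LinearMap.rTensor K[X] (LinearMap.snd K A M) b.1.2 = 0}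
  | .S0 => {b | b.1.2 = 0 ∧ LinearMap.rTensor K[X] (LinearMap.fst K A M) b.1.1 = 0}
  | .S1 => {b | b.1.1 = 0 ∧ LinearMap.rTensor K[X] (LinearMap.fst K A M) b.1.2 = 0}

/-- The element `x q(t)dt` of `B(A,M)`, for `x` in `A ⊕ M`. -/
def fiberDt {K A M : Type*} [Field K] [AddCommGroup A] [Module K A] [AddCommGroup M]
    [Module K M] (x : A × M) (q : K[X]) : fiberSub K A M :=
  ⟨(0, x ⊗ₜ q), by simp [fiberSub]⟩

/-! ### The reduced tensor coalgebra and the bar construction -/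

/-- `T̄(V)`, the direct sum of the tensor powers `V^{⊗ n}`, `n ≥ 1`. -/
abbrev RedTensor (K V : Type*) [Field K] [AddCommGroup V] [Module K V] : Type _ :=
  DirectSum ℕ (fun n => ⨂[K]^(n + 1) V)

namespace RedTensor

variable {K V : Type*} [Field K] [AddCommGroup V] [Module K V]

/-- The element `v₀ ⊗ ⋯ ⊗ vₙ`. -/
def word {n : ℕ} (v : Fin (n + 1) → V) : RedTensor K V :=
  DirectSum.lof K ℕ (fun n => ⨂[K]^(n + 1) V) n (PiTensorProduct.tprod K v)

/-- The letters of the word obtained from `v₀ ⊗ ⋯ ⊗ vₙ₊₁` by applying `s` to the letters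
before position `i` and `f` to the letters in positions `i` and `i + 1`. -/
def mergeFun {n : ℕ} (s : V →ₗ[K] V) (f : V →ₗ[K] V →ₗ[K] V) (i : Fin (n + 1))
    (v : Fin (n + 2) → V) (j : Fin (n + 1)) : V :=
  if j < i then s (v j.castSucc)
  else if j = i then f (v j.castSucc) (v j.succ)
  else v j.succ

theorem mergeFun_update {n : ℕ} (s : V →ₗ[K] V) (f : V →ₗ[K] V →ₗ[K] V) (i : Fin (n + 1))
    (v : Fin (n + 2) → V) (k : Fin (n + 2)) :
    ∃ (l : Fin (n + 1)) (g : V →ₗ[K] V), ∀ x : V,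
      mergeFun s f i (Function.update v k x) = Function.update (mergeFun s f i v) l (g x) := by
  have hne : ∀ (a b : Fin (n + 2)) (x : V), a.val ≠ b.val → Function.update v b x a = v a :=
    fun a b x h => Function.update_of_ne (fun e => h (congrArg Fin.val e)) _ _
  rcases lt_trichotomy k.val i.val with h | h | h
  · refine ⟨⟨k.val, by omega⟩, s, fun x => ?_⟩
    funext j
    by_cases hj : j.val = k.val
    · have e1 : j = ⟨k.val, by omega⟩ := Fin.ext hj
      have e2 : j.castSucc = k := Fin.ext hj
      have e3 : j < i := by rw [Fin.lt_def]; omega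
      rw [← e1, Function.update_self, mergeFun, if_pos e3, e2, Function.update_self]
    · rw [Function.update_of_ne (fun e => hj (congrArg Fin.val e))]
      unfold mergeFun
      rw [hne _ _ _ (show j.castSucc.val ≠ k.val from hj)]
      by_cases h1 : j < i
      · rw [if_pos h1, if_pos h1]
      · rw [Fin.lt_def] at h1
        rw [hne _ _ _ (show j.succ.val ≠ k.val by rw [Fin.val_succ]; omega)]
  · refine ⟨i, f.flip (v i.succ), fun x => ?_⟩
    funext j
    by_cases hj : j = i
    · subst hj
      have e2 : j.castSucc = k := Fin.ext h.symm
      rw [Function.update_self, mergeFun, if_neg (lt_irrefl _), if_pos rfl, e2,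
        Function.update_self, hne _ _ _ (show j.succ.val ≠ k.val by rw [Fin.val_succ]; omega)]
      rfl
    · rw [Function.update_of_ne hj]
      have hj' : j.val ≠ i.val := fun e => hj (Fin.ext e)
      unfold mergeFun
      rw [hne _ _ _ (show j.castSucc.val ≠ k.val by rw [Fin.val_castSucc]; omega),
        if_neg hj, if_neg hj]
      by_cases h1 : j < i
      · rw [if_pos h1, if_pos h1]
      · rw [Fin.lt_def] at h1
        rw [hne _ _ _ (show j.succ.val ≠ k.val by rw [Fin.val_succ]; omega)]
  · refine ⟨⟨k.val - 1, by omega⟩,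
      if k.val = i.val + 1 then f (v i.castSucc) else LinearMap.id, fun x => ?_⟩
    funext j
    by_cases hj : j.val = k.val - 1
    · have e1 : j = ⟨k.val - 1, by omega⟩ := Fin.ext hj
      have e2 : j.succ = k := Fin.ext (by rw [Fin.val_succ]; omega)
      have e3 : ¬ j < i := by rw [Fin.lt_def]; omega
      rw [← e1, Function.update_self, mergeFun, if_neg e3, e2, Function.update_self,
        hne _ _ _ (show j.castSucc.val ≠ k.val by rw [Fin.val_castSucc]; omega)]
      by_cases h1 : j = i
      · rw [if_pos h1, if_pos (by rw [← h1]; omega), h1]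
      · have h1' : j.val ≠ i.val := fun e => h1 (Fin.ext e)
        rw [if_neg h1, if_neg (by omega)]
        rfl
    · rw [Function.update_of_ne (fun e => hj (congrArg Fin.val e))]
      unfold mergeFun
      rw [hne j.succ k x (by rw [Fin.val_succ]; omega)]
      by_cases h1 : j < i
      · rw [if_pos h1, if_pos h1, hne _ _ _ (show j.castSucc.val ≠ k.val by
          rw [Fin.lt_def] at h1; rw [Fin.val_castSucc]; omega)]
      · rw [if_neg h1, if_neg h1]
        by_cases h2 : j = i
        · rw [if_pos h2, if_pos h2, hne _ _ _ (show j.castSucc.val ≠ k.val by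
            rw [h2, Fin.val_castSucc]; omega)]
        · rw [if_neg h2, if_neg h2]

/-- The linear map
`v₀ ⊗ ⋯ ⊗ vₙ₊₁ ↦ s v₀ ⊗ ⋯ ⊗ s vᵢ₋₁ ⊗ f(vᵢ, vᵢ₊₁) ⊗ vᵢ₊₂ ⊗ ⋯ ⊗ vₙ₊₁`. -/
def merge (n : ℕ) (s : V →ₗ[K] V) (f : V →ₗ[K] V →ₗ[K] V) (i : Fin (n + 1)) :
    ⨂[K]^(n + 2) V →ₗ[K] ⨂[K]^(n + 1) V :=
  PiTensorProduct.lift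
    { toFun := fun v => PiTensorProduct.tprod K (mergeFun s f i v)
      map_update_add' := by
        intro dec v k x y
        obtain rfl : dec = instDecidableEqFin (n + 2) := Subsingleton.elim _ _
        obtain ⟨l, g, h⟩ := mergeFun_update s f i v k
        rw [h, h, h, map_add, MultilinearMap.map_update_add]
      map_update_smul' := by
        intro dec v k c x
        obtain rfl : dec = instDecidableEqFin (n + 2) := Subsingleton.elim _ _
        obtain ⟨l, g, h⟩ := mergeFun_update s f i v k
        rw [h, h, map_smul, MultilinearMap.map_update_smul] }

/-- The linear map
`v₀ ⊗ ⋯ ⊗ vₙ ↦ s v₀ ⊗ ⋯ ⊗ s vᵢ₋₁ ⊗ f vᵢ ⊗ vᵢ₊₁ ⊗ ⋯ ⊗ vₙ`. -/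
def applyAt (n : ℕ) (s f : V →ₗ[K] V) (i : Fin (n + 1)) :
    ⨂[K]^(n + 1) V →ₗ[K] ⨂[K]^(n + 1) V :=
  PiTensorProduct.map fun j => if j < i then s else if j = i then f else LinearMap.id

/-- The degree `+1` coderivation of `T̄(V)` induced by a degree `+1` map `f : V → V`; here `s` is
the sign operator of `V`, which accounts for moving `f` across the first letters. -/
def coder₁ (s f : V →ₗ[K] V) : RedTensor K V →ₗ[K] RedTensor K V :=
  DirectSum.toModule K ℕ _ fun n =>
    ∑ i : Fin (n + 1),
      DirectSum.lof K ℕ (fun n => ⨂[K]^(n + 1) V) n ∘ₗ applyAt n s f i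

/-- The degree `+1` coderivation of `T̄(V)` induced by a degree `+1` map `f : V ⊗ V → V`. -/
def coder₂ (s : V →ₗ[K] V) (f : V →ₗ[K] V →ₗ[K] V) : RedTensor K V →ₗ[K] RedTensor K V :=
  DirectSum.toModule K ℕ _ fun n =>
    match n with
    | 0 => 0
    | n + 1 => ∑ i : Fin (n + 1),
        DirectSum.lof K ℕ (fun n => ⨂[K]^(n + 1) V) n ∘ₗ merge n s f i

end RedTensor

namespace DGAlg

variable {K A C : Type*} [Field K] [AddCommGroup A] [Module K A] [AddCommGroup C] [Module K C]

/-- The differential `q₁ = d` of `A[1]`. -/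
def barQ₁ (R : DGAlg K A) : A →ₗ[K] A := (R.shift 1).d

/-- The map `q₂(a, b) = (-1)^|a| a b` of degree `+1` on `A[1]`, where `|a|` is the degree of `a`
in `A[1]`. -/
def barQ₂ (R : DGAlg K A) : A →ₗ[K] A →ₗ[K] A := R.mul ∘ₗ (R.shift 1).sgn

/-- The differential `Q = Q₁ + Q₂` of the bar construction `T̄(A[1])`. -/
def barD (R : DGAlg K A) : RedTensor K A →ₗ[K] RedTensor K A :=
  RedTensor.coder₁ (R.shift 1).sgn R.barQ₁ + RedTensor.coder₂ (R.shift 1).sgn R.barQ₂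

/-- A linear map `F : T̄(A[1]) → C[1]` is an `A_∞` morphism `A → C` of DG algebras if it has
degree `0` and its components satisfy the structure equations
`F(Q(b₀ ⊗ ⋯ ⊗ bₙ)) = q₁ F(b₀ ⊗ ⋯ ⊗ bₙ) + ∑ᵢ q₂(F(b₀ ⊗ ⋯ ⊗ bᵢ), F(bᵢ₊₁ ⊗ ⋯ ⊗ bₙ))`,
that is, the coalgebra morphism `T̄(A[1]) → T̄(C[1])` with corestriction `F` commutes with the
differentials of the bar constructions. -/
structure IsAInfinityMorphism (R : DGAlg K A) (S : DGAlg K C) (F : RedTensor K A →ₗ[K] C) :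
    Prop where
  map_mem : ∀ (n : ℕ) (e : Fin (n + 1) → ℤ) (b : Fin (n + 1) → A),
    (∀ i, b i ∈ (R.shift 1).gr (e i)) →
      F (RedTensor.word b) ∈ (S.shift 1).gr (∑ i, e i)
  map_barD : ∀ (n : ℕ) (b : Fin (n + 1) → A),
    F (R.barD (RedTensor.word b)) = S.barQ₁ (F (RedTensor.word b)) +
      ∑ i : Fin n, S.barQ₂
        (F (RedTensor.word fun j : Fin (i.val + 1) => b ⟨j.val, by omega⟩))
        (F (RedTensor.word fun j : Fin (n - 1 - i.val + 1) =>
          b ⟨i.val + 1 + j.val, by omega⟩))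

/-- The linear part `A[1] → C[1]` of a linear map `T̄(A[1]) → C[1]`. -/
def linearPart (F : RedTensor K A →ₗ[K] C) : A →ₗ[K] C where
  toFun a := F (RedTensor.word fun _ : Fin (0 + 1) => a)
  map_add' a b := by
    have h : ∀ x : A, (fun _ : Fin (0 + 1) => x) = Function.update (fun _ => a) 0 x := by
      intro x; funext i; fin_cases i; simp
    simp only [RedTensor.word]
    rw [h (a + b), MultilinearMap.map_update_add, ← h a, ← h b, map_add, map_add]
  map_smul' c a := by
    have h : ∀ x : A, (fun _ : Fin (0 + 1) => x) = Function.update (fun _ => a) 0 x := by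
      intro x; funext i; fin_cases i; simp
    simp only [RedTensor.word]
    rw [h (c • a), MultilinearMap.map_update_smul, ← h a, map_smul, map_smul, RingHom.id_apply]

/-- An `A_∞` quasi-isomorphism: an `A_∞` morphism whose linear part is a quasi-isomorphism. -/
def IsAInfinityQuasiIso (R : DGAlg K A) (S : DGAlg K C) (F : RedTensor K A →ₗ[K] C) : Prop :=
  IsAInfinityMorphism R S F ∧
    DGVec.IsQuasiIso (R.shift 1) (S.shift 1) (linearPart F)

end DGAlg

/-! ### Iterated integrals -/

/-- The primitive vanishing at `0`: `tⁿ ↦ tⁿ⁺¹ / (n + 1)`. -/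
def primitive (K : Type*) [Field K] : K[X] →ₗ[K] K[X] :=
  Polynomial.lsum fun n => ((n + 1 : K)⁻¹) • Polynomial.monomial (n + 1)

/-- The polynomial
`t ↦ ∫_{0 ≤ t₁ ≤ ⋯ ≤ tₙ ≤ t} p₁(t₁) ⋯ pₙ(tₙ) dt₁ ⋯ dtₙ`. -/
def iterPrimitive {K : Type*} [Field K] : (n : ℕ) → (Fin n → K[X]) → K[X]
  | 0, _ => 1
  | n + 1, p => primitive K (iterPrimitive n (Fin.init p) * p (Fin.last n))

/-- `∫ₙ p₁ ⊗ ⋯ ⊗ pₙ`, the integral of `p₁(t₁) ⋯ pₙ(tₙ)` over `0 ≤ t₁ ≤ ⋯ ≤ tₙ ≤ 1`. -/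
def iterIntegral {K : Type*} [Field K] {n : ℕ} (p : Fin n → K[X]) : K :=
  (iterPrimitive n p).eval 1

/-- `a₁ ⋯ aₙ m`. -/
def actProd {K A M : Type*} [Field K] [AddCommGroup A] [Module K A] [AddCommGroup M]
    [Module K M] {R : DGAlg K A} (N : DGMod R M) {n : ℕ} (a : Fin n → A) (m : M) : M :=
  (List.ofFn a).foldr (fun x y => N.act x y) m

/-- The defining properties of `∫_∞ : T̄(B(A,M)[1]) → M`: its value on
`a₁ q₁(t)dt ⊗ ⋯ ⊗ aₙ qₙ(t)dt ⊗ m p(t)dt`, and its vanishing on every tensor product of the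
summands `R₀, R₁, S₀, S₁` that is not of the form `R₁^{⊗ n} ⊗ S₁`. -/
structure IsIterIntegralMap {K A M : Type*} [Field K] [AddCommGroup A] [Module K A]
    [AddCommGroup M] [Module K M] {R : DGAlg K A} (N : DGMod R M)
    (F : RedTensor K (fiberSub K A M) →ₗ[K] M) : Prop where
  map_dt : ∀ (n : ℕ) (a : Fin n → A) (q : Fin n → K[X]) (m : M) (p : K[X]),
    F (RedTensor.word (Fin.snoc (α := fun _ => fiberSub K A M)
        (fun i => fiberDt (a i, 0) (q i)) (fiberDt (0, m) p))) =
      iterIntegral (Fin.snoc (α := fun _ => K[X]) q p) • actProd N a m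
  map_other : ∀ (n : ℕ) (c : Fin (n + 1) → FiberPart) (b : Fin (n + 1) → fiberSub K A M),
    (∀ i, b i ∈ fiberPart K A M (c i)) →
    ¬ ((∀ i : Fin n, c i.castSucc = .R1) ∧ c (Fin.last n) = .S1) →
      F (RedTensor.word b) = 0

end

noncomputable section

/-! ### Primitives of polynomials -/

section Primitive

variable {K : Type*} [Field K]

/-! Integrating from the right makes the map recursive in the first letter, which suits a left
module. For letters b₀, …, bₙ let I(b₀,…,bₙ)(t) ∈ M[t] be the integral of the dt-coefficients over t
≤ t₀ ≤ ⋯ ≤ tₙ ≤ 1. Then I(b₀,…,bₙ)(t) is ∫ₜ¹ of the A-coefficient of dt in b₀ acting on I(b₁,…,bₙ),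
and ∫_∞ is the value of I at t = 0. The theorem's iterated integral is built from the other end, by
primitives vanishing at 0; integration by parts identifies the two recursions
(`iterIntegral_eq_foldr`).

Since M[-1] has trivial product, the structure equations reduce to ∫_∞ ∘ Q = d ∘ ∫_∞. This is
Stokes' formula, proved for every t (`upperSum_eq`): I applied to Q(b₀ ⊗ ⋯ ⊗ bₙ) equals dI minus a
boundary term at t₀ = t. In the inductive step, q₁ on the first letter contributes the derivative of
its function part a₀, and q₂ on the first two letters contributes a product with a₀; together they
form a total derivative. The other product with the first letter cancels the boundary term of the
shorter word. The upper endpoint contributes nothing because m(1) = 0 and I vanishes at 1. At t = 0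
the boundary term vanishes because a(0) = 0 and m(0) = 0 (`polyEval_upperBoundary`).

Uniqueness holds because the four summands, with R₁ and S₁ further reduced to elements x q(t)dt,
span B(A,M), and the two defining properties fix the value on every word in such elements.

The linear part sends x + y dt to ∫₀¹ of the M-component of y. It hits a cocycle m at m dt. If x + y
dt is closed and its integral is dn, then integrating y from 0 and correcting by a linear term in t
and by n dt gives a primitive satisfying the boundary conditions (`formsD_homotopy`). Hence it is
bijective on cohomology. -/

theorem primitive_monomial (n : ℕ) (c : K) :
    primitive K (Polynomial.monomial n c) = Polynomial.monomial (n + 1) ((n + 1 : K)⁻¹ * c) := by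
  simp [primitive, Polynomial.sum_monomial_index, Polynomial.smul_monomial]

@[simp]
theorem eval_zero_primitive (p : K[X]) : (primitive K p).eval 0 = 0 := by
  induction p using Polynomial.induction_on' with
  | add p q hp hq => simp [hp, hq]
  | monomial n c => simp [primitive_monomial]

variable [CharZero K]

@[simp]
theorem derivative_primitive (p : K[X]) : Polynomial.derivative (primitive K p) = p := by
  induction p using Polynomial.induction_on' with
  | add p q hp hq => simp [hp, hq]
  | monomial n c =>
    have h : (n + 1 : K) ≠ 0 := by exact_mod_cast n.succ_ne_zero
    rw [primitive_monomial, Polynomial.derivative_monomial]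
    congr 1
    push_cast
    field_simp

/-- In characteristic 0 a polynomial with zero derivative is constant, and the constant is read off
at 0. -/
theorem primitive_derivative (p : K[X]) :
    primitive K (Polynomial.derivative p) = p - Polynomial.C (p.eval 0) := by
  have h : Polynomial.derivative (primitive K (Polynomial.derivative p) - p) = 0 := by simp
  have h1 := Polynomial.eq_C_of_derivative_eq_zero h
  rw [Polynomial.coeff_zero_eq_eval_zero, Polynomial.eval_sub, eval_zero_primitive,
    zero_sub, Polynomial.C_neg] at h1
  linear_combination h1

end Primitive

/-! ### Integration from t to 1, and the two recursions for integrals over a simplex -/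

section Coprimitive

/-- The polynomial `t ↦ ∫ₜ¹ p`. -/
def coprimitive (K : Type*) [Field K] : K[X] →ₗ[K] K[X] :=
  Polynomial.monomial 0 ∘ₗ Polynomial.leval 1 ∘ₗ primitive K - primitive K

variable {K : Type*} [Field K]

theorem coprimitive_apply (p : K[X]) :
    coprimitive K p = Polynomial.C ((primitive K p).eval 1) - primitive K p := by
  simp [coprimitive, Polynomial.leval]

@[simp]
theorem eval_one_coprimitive (p : K[X]) : (coprimitive K p).eval 1 = 0 := by
  simp [coprimitive_apply]

@[simp]
theorem eval_zero_coprimitive (p : K[X]) :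
    (coprimitive K p).eval 0 = (primitive K p).eval 1 := by
  simp [coprimitive_apply]

/-- The recursion of `iterPrimitive` peels off the last variable; as a left fold over a list it can
be unrolled from the first variable instead. -/
theorem iterPrimitive_eq_foldl (n : ℕ) (q : Fin n → K[X]) :
    iterPrimitive n q = (List.ofFn q).foldl (fun r s => primitive K (r * s)) 1 := by
  induction n with
  | zero => simp [iterPrimitive]
  | succ n ih =>
    rw [iterPrimitive, ih, List.ofFn_succ', List.concat_eq_append, List.foldl_append]
    rfl

variable [CharZero K]

@[simp]
theorem derivative_coprimitive (p : K[X]) : Polynomial.derivative (coprimitive K p) = -p := by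
  simp [coprimitive_apply]

theorem coprimitive_derivative (p : K[X]) :
    coprimitive K (Polynomial.derivative p) = Polynomial.C (p.eval 1) - p := by
  rw [coprimitive_apply, primitive_derivative]
  simp

/-- Integration by parts over `[0, 1]`. -/
theorem eval_one_primitive_by_parts (p q : K[X]) :
    (primitive K (primitive K p * q)).eval 1 = (primitive K (p * coprimitive K q)).eval 1 := by
  -- This product vanishes at both ends of [0, 1], so integrating its derivative leaves no boundary
  -- term.
  have h := primitive_derivative (primitive K p * coprimitive K q)
  rw [Polynomial.derivative_mul, derivative_primitive, derivative_coprimitive, mul_neg,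
    map_add, map_neg] at h
  have h1 := congrArg (Polynomial.eval 1) h
  simp only [Polynomial.eval_add, Polynomial.eval_neg, Polynomial.eval_sub, Polynomial.eval_mul,
    eval_one_coprimitive, eval_zero_primitive, mul_zero, zero_mul, Polynomial.eval_C] at h1
  linear_combination -h1

/-- The accumulator `p` must be arbitrary: each step of the left fold replaces it by a primitive,
and integration by parts moves that integration onto the remaining variables. -/
theorem eval_one_foldl_primitive (qs : List K[X]) (p q : K[X]) :
    ((q :: qs).foldl (fun r s => primitive K (r * s)) p).eval 1 =
      (primitive K (p * (q * qs.foldr (fun r s => coprimitive K (r * s)) 1))).eval 1 := by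
  induction qs generalizing p q with
  | nil => simp
  | cons q' qs ih =>
    rw [List.foldl_cons, ih, eval_one_primitive_by_parts, List.foldr_cons, mul_assoc]

/-- The iterated integral over a simplex, integrating over the last variable first. -/
theorem iterIntegral_eq_foldr (n : ℕ) (q : Fin (n + 1) → K[X]) :
    iterIntegral q =
      ((List.ofFn q).foldr (fun r s => coprimitive K (r * s)) 1).eval 0 := by
  rw [iterIntegral, iterPrimitive_eq_foldl, List.ofFn_succ, eval_one_foldl_primitive, one_mul,
    List.foldr_cons, eval_zero_coprimitive]

end Coprimitive

/-! ### Polynomials with coefficients in a module -/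

section PolyOps

variable {K V W A M : Type*} [Field K] [AddCommGroup V] [Module K V]
  [AddCommGroup W] [Module K W] [AddCommGroup A] [Module K A] [AddCommGroup M] [Module K M]

open DGVec

/-- Allowing two evaluation points lets ∫₀¹ be read both as the primitive at 1 and as the
coprimitive at 0. -/
theorem polyEval_lTensor (c c' : K) (f : K[X] →ₗ[K] K[X]) (g : K[X] →ₗ[K] K[X])
    (h : ∀ p, (f p).eval c = (g p).eval c') (x : V ⊗[K] K[X]) :
    polyEval K V c (LinearMap.lTensor V f x) = polyEval K V c' (LinearMap.lTensor V g x) := by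
  induction x using TensorProduct.induction_on with
  | zero => simp
  | tmul v p => simp [h]
  | add x y hx hy => simp only [map_add, hx, hy]

/-- `∫ₜ¹` on polynomials with coefficients in `V`. -/
def polyCoprim (K V : Type*) [Field K] [AddCommGroup V] [Module K V] :
    V ⊗[K] K[X] →ₗ[K] V ⊗[K] K[X] :=
  LinearMap.lTensor V (coprimitive K)

@[simp]
theorem polyCoprim_tmul (v : V) (p : K[X]) :
    polyCoprim K V (v ⊗ₜ p) = v ⊗ₜ coprimitive K p := rfl

@[simp]
theorem polyEval_one_polyCoprim (x : V ⊗[K] K[X]) :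
    polyEval K V 1 (polyCoprim K V x) = 0 := by
  induction x using TensorProduct.induction_on with
  | zero => simp
  | tmul v p => simp
  | add x y hx hy => simp only [map_add, hx, hy, add_zero]

theorem rTensor_polyCoprim (f : V →ₗ[K] W) (x : V ⊗[K] K[X]) :
    LinearMap.rTensor K[X] f (polyCoprim K V x) =
      polyCoprim K W (LinearMap.rTensor K[X] f x) := by
  induction x using TensorProduct.induction_on with
  | zero => simp
  | tmul v p => simp
  | add x y hx hy => simp only [map_add, hx, hy]

theorem polyCoprim_derivative [CharZero K] (x : V ⊗[K] K[X]) :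
    polyCoprim K V (LinearMap.lTensor V (Polynomial.derivative (R := K)) x) =
      polyEval K V 1 x ⊗ₜ 1 - x := by
  induction x using TensorProduct.induction_on with
  | zero => simp
  | tmul v p =>
    have h : Polynomial.C (p.eval 1) = p.eval 1 • (1 : K[X]) := by
      rw [Polynomial.smul_eq_C_mul, mul_one]
    simp [coprimitive_derivative, TensorProduct.tmul_sub, TensorProduct.smul_tmul, h]
  | add x y hx hy => simp only [map_add, hx, hy, TensorProduct.add_tmul]; abel

theorem derivative_polyCoprim [CharZero K] (x : V ⊗[K] K[X]) :
    LinearMap.lTensor V (Polynomial.derivative (R := K)) (polyCoprim K V x) = -x := by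
  induction x using TensorProduct.induction_on with
  | zero => simp
  | tmul v p => simp [TensorProduct.tmul_neg]
  | add x y hx hy => simp only [map_add, hx, hy, neg_add]

/-- The action of `A[t]` on `M[t]`. -/
def DGMod.polyAct {R : DGAlg K A} (N : DGMod R M) :
    A ⊗[K] K[X] →ₗ[K] M ⊗[K] K[X] →ₗ[K] M ⊗[K] K[X] :=
  TensorProduct.map₂ N.act (LinearMap.mul K K[X])

@[simp]
theorem DGMod.polyAct_tmul {R : DGAlg K A} (N : DGMod R M) (a : A) (m : M) (p q : K[X]) :
    N.polyAct (a ⊗ₜ p) (m ⊗ₜ q) = N.act a m ⊗ₜ (p * q) := by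
  simp [DGMod.polyAct]

/-- Bilinear identities on `A[t] × M[t]` may be checked on pure tensors. -/
theorem polyBilin_ext {f g : A ⊗[K] K[X] →ₗ[K] M ⊗[K] K[X] →ₗ[K] V}
    (h : ∀ a p m q, f (a ⊗ₜ p) (m ⊗ₜ q) = g (a ⊗ₜ p) (m ⊗ₜ q)) : f = g :=
  TensorProduct.ext' fun a p => TensorProduct.ext' fun m q => h a p m q

/-- With the sign operator in place of (-1)^i the Leibniz rule holds for inhomogeneous elements, so
it extends to polynomial coefficients by linearity. -/
theorem DGMod.leibniz_sgn {R : DGAlg K A} (N : DGMod R M) (a : A) (m : M) :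
    N.d (N.act a m) = N.act (R.d a) m + N.act (R.sgn a) (N.d m) := by
  have : N.act.compr₂ N.d = N.act.comp R.d + N.act.compl₁₂ R.sgn N.d := by
    refine R.hom_ext fun i a ha => LinearMap.ext fun m => ?_
    simp only [LinearMap.compr₂_apply, LinearMap.compl₁₂_apply, LinearMap.add_apply,
      LinearMap.comp_apply]
    rw [N.leibniz i a m ha, R.sgn_of_mem ha, map_smul, LinearMap.smul_apply]
  exact LinearMap.congr_fun₂ this a m

theorem DGMod.polyD_polyAct {R : DGAlg K A} (N : DGMod R M) (x : A ⊗[K] K[X])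
    (y : M ⊗[K] K[X]) :
    LinearMap.rTensor K[X] N.d (N.polyAct x y) =
      N.polyAct (LinearMap.rTensor K[X] R.d x) y +
        N.polyAct (R.polySgn x) (LinearMap.rTensor K[X] N.d y) := by
  have : N.polyAct.compr₂ (LinearMap.rTensor K[X] N.d) =
      N.polyAct.comp (LinearMap.rTensor K[X] R.d) +
        N.polyAct.compl₁₂ R.polySgn (LinearMap.rTensor K[X] N.d) :=
    polyBilin_ext fun a p m q => by
      simp [polySgn, N.leibniz_sgn, TensorProduct.add_tmul]
  exact LinearMap.congr_fun₂ this x y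

theorem DGMod.polyDer_polyAct {R : DGAlg K A} (N : DGMod R M) (x : A ⊗[K] K[X])
    (y : M ⊗[K] K[X]) :
    LinearMap.lTensor M (Polynomial.derivative (R := K)) (N.polyAct x y) =
      N.polyAct (LinearMap.lTensor A (Polynomial.derivative (R := K)) x) y +
        N.polyAct x (LinearMap.lTensor M (Polynomial.derivative (R := K)) y) := by
  have : N.polyAct.compr₂ (LinearMap.lTensor M (Polynomial.derivative (R := K))) =
      N.polyAct.comp (LinearMap.lTensor A (Polynomial.derivative (R := K))) +
        N.polyAct.compl₁₂ LinearMap.id (LinearMap.lTensor M (Polynomial.derivative (R := K))) :=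
    polyBilin_ext fun a p m q => by
      simp [Polynomial.derivative_mul, TensorProduct.tmul_add]
  exact LinearMap.congr_fun₂ this x y

theorem DGMod.polyEval_polyAct {R : DGAlg K A} (N : DGMod R M) (c : K) (x : A ⊗[K] K[X])
    (y : M ⊗[K] K[X]) :
    polyEval K M c (N.polyAct x y) = N.act (polyEval K A c x) (polyEval K M c y) := by
  have : N.polyAct.compr₂ (polyEval K M c) =
      N.act.compl₁₂ (polyEval K A c) (polyEval K M c) :=
    polyBilin_ext fun a p m q => by simp [smul_smul, mul_comm]
  exact LinearMap.congr_fun₂ this x y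

theorem DGMod.polyAct_mem {R : DGAlg K A} (N : DGMod R M) {i j : ℤ} {x : A ⊗[K] K[X]}
    {y : M ⊗[K] K[X]} (hx : x ∈ R.polyGr i) (hy : y ∈ N.polyGr j) :
    N.polyAct x y ∈ N.polyGr (i + j) := by
  obtain ⟨x, rfl⟩ := hx
  obtain ⟨y, rfl⟩ := hy
  induction x using TensorProduct.induction_on with
  | zero => simp
  | add x x' hx hx' =>
    simp only [map_add, LinearMap.add_apply]; exact Submodule.add_mem _ hx hx'
  | tmul a p =>
    induction y using TensorProduct.induction_on with
    | zero => simp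
    | add y y' hy hy' => simp only [map_add]; exact Submodule.add_mem _ hy hy'
    | tmul m q => exact ⟨⟨N.act a m, N.act_mem i j a m a.2 m.2⟩ ⊗ₜ (p * q), by simp⟩

/-! ### Degrees and signs of polynomials with graded coefficients -/

theorem DGVec.polyEval_mem (C : DGVec K V) (c : K) {i : ℤ} {x : V ⊗[K] K[X]}
    (hx : x ∈ C.polyGr i) : polyEval K V c x ∈ C.gr i := by
  obtain ⟨x, rfl⟩ := hx
  rw [polyEval_rTensor]
  exact Subtype.mem _

theorem DGVec.tmul_mem_polyGr (C : DGVec K V) {i : ℤ} {v : V} (hv : v ∈ C.gr i) (p : K[X]) :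
    v ⊗ₜ p ∈ C.polyGr i :=
  ⟨(⟨v, hv⟩ : C.gr i) ⊗ₜ p, by simp⟩

theorem DGVec.polySgn_mem (C : DGVec K V) {i : ℤ} {x : V ⊗[K] K[X]} (hx : x ∈ C.polyGr i) :
    C.polySgn x ∈ C.polyGr i := by
  rw [DGAlg.polySgn_of_mem C hx]; exact Submodule.smul_mem _ _ hx

theorem DGVec.lTensor_mem_polyGr (C : DGVec K V) {i : ℤ} (f : K[X] →ₗ[K] K[X])
    {x : V ⊗[K] K[X]} (hx : x ∈ C.polyGr i) : LinearMap.lTensor V f x ∈ C.polyGr i :=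
  C.map_polyGr C LinearMap.id f (fun _ hv => hv) hx

theorem DGVec.map_sgn_eq (C : DGVec K V) (f : K[X] →ₗ[K] K[X]) (x : V ⊗[K] K[X]) :
    TensorProduct.map C.sgn f x = C.polySgn (LinearMap.lTensor V f x) := by
  unfold polySgn
  rw [← LinearMap.comp_apply, LinearMap.rTensor_comp_lTensor]

theorem DGVec.polySgn_lTensor (C : DGVec K V) (f : K[X] →ₗ[K] K[X]) (x : V ⊗[K] K[X]) :
    C.polySgn (LinearMap.lTensor V f x) = LinearMap.lTensor V f (C.polySgn x) := by
  unfold polySgn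
  rw [← LinearMap.comp_apply, LinearMap.rTensor_comp_lTensor, ← LinearMap.lTensor_comp_rTensor,
    LinearMap.comp_apply]

end PolyOps

section FiberParts

variable {K A M : Type*} [Field K] [AddCommGroup A] [Module K A] [AddCommGroup M] [Module K M]

open DGVec

/-! ### Components of elements of `B(A,M)` -/

variable (K A M) in
/-- The component in `A[t]`. -/
def fnA : fiberSub K A M →ₗ[K] A ⊗[K] K[X] :=
  LinearMap.rTensor K[X] (LinearMap.fst K A M) ∘ₗ LinearMap.fst K _ _ ∘ₗ Submodule.subtype _

variable (K A M) in
/-- The component in `M[t]`. -/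
def fnM : fiberSub K A M →ₗ[K] M ⊗[K] K[X] :=
  LinearMap.rTensor K[X] (LinearMap.snd K A M) ∘ₗ LinearMap.fst K _ _ ∘ₗ Submodule.subtype _

variable (K A M) in
/-- The coefficient of `dt` in `A[t]`. -/
def dtA : fiberSub K A M →ₗ[K] A ⊗[K] K[X] :=
  LinearMap.rTensor K[X] (LinearMap.fst K A M) ∘ₗ LinearMap.snd K _ _ ∘ₗ Submodule.subtype _

variable (K A M) in
/-- The coefficient of `dt` in `M[t]`. -/
def dtM : fiberSub K A M →ₗ[K] M ⊗[K] K[X] :=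
  LinearMap.rTensor K[X] (LinearMap.snd K A M) ∘ₗ LinearMap.snd K _ _ ∘ₗ Submodule.subtype _

theorem polyEval_zero_fnA (b : fiberSub K A M) : polyEval K A 0 (fnA K A M b) = 0 :=
  (polyEval_rTensor 0 _ _).trans b.2.1

theorem polyEval_zero_fnM (b : fiberSub K A M) : polyEval K M 0 (fnM K A M b) = 0 :=
  (polyEval_rTensor 0 _ _).trans b.2.2.1

theorem polyEval_one_fnM (b : fiberSub K A M) : polyEval K M 1 (fnM K A M b) = 0 :=
  (polyEval_rTensor 1 _ _).trans b.2.2.2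

variable {R : DGAlg K A} (N : DGMod R M)

theorem fst_polySgn (x : (A × M) ⊗[K] K[X]) :
    LinearMap.rTensor K[X] (LinearMap.fst K A M) ((R.semidirect N).polySgn x) =
      R.polySgn (LinearMap.rTensor K[X] (LinearMap.fst K A M) x) := by
  have h : LinearMap.fst K A M ∘ₗ (R.semidirect N).sgn = R.sgn ∘ₗ LinearMap.fst K A M :=
    (R.semidirect N).hom_ext fun i v hv => by
      rw [LinearMap.comp_apply, LinearMap.comp_apply, (R.semidirect N).sgn_of_mem hv, map_smul]
      exact (R.sgn_of_mem hv.1).symm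
  unfold polySgn
  rw [← LinearMap.comp_apply, ← LinearMap.rTensor_comp, h, LinearMap.rTensor_comp,
    LinearMap.comp_apply]

theorem snd_polySgn (x : (A × M) ⊗[K] K[X]) :
    LinearMap.rTensor K[X] (LinearMap.snd K A M) ((R.semidirect N).polySgn x) =
      N.polySgn (LinearMap.rTensor K[X] (LinearMap.snd K A M) x) := by
  have h : LinearMap.snd K A M ∘ₗ (R.semidirect N).sgn = N.sgn ∘ₗ LinearMap.snd K A M :=
    (R.semidirect N).hom_ext fun i v hv => by
      rw [LinearMap.comp_apply, LinearMap.comp_apply, (R.semidirect N).sgn_of_mem hv, map_smul]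
      exact (N.sgn_of_mem hv.2).symm
  unfold polySgn
  rw [← LinearMap.comp_apply, ← LinearMap.rTensor_comp, h, LinearMap.rTensor_comp,
    LinearMap.comp_apply]

theorem fst_polyD (x : (A × M) ⊗[K] K[X]) :
    LinearMap.rTensor K[X] (LinearMap.fst K A M)
        (LinearMap.rTensor K[X] (R.semidirect N).d x) =
      LinearMap.rTensor K[X] R.d (LinearMap.rTensor K[X] (LinearMap.fst K A M) x) := by
  rw [← LinearMap.comp_apply, ← LinearMap.rTensor_comp, ← LinearMap.comp_apply,
    ← LinearMap.rTensor_comp]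
  rfl

theorem snd_polyD (x : (A × M) ⊗[K] K[X]) :
    LinearMap.rTensor K[X] (LinearMap.snd K A M)
        (LinearMap.rTensor K[X] (R.semidirect N).d x) =
      LinearMap.rTensor K[X] N.d (LinearMap.rTensor K[X] (LinearMap.snd K A M) x) := by
  rw [← LinearMap.comp_apply, ← LinearMap.rTensor_comp, ← LinearMap.comp_apply,
    ← LinearMap.rTensor_comp]
  rfl

theorem fst_polyMul (x y : (A × M) ⊗[K] K[X]) :
    LinearMap.rTensor K[X] (LinearMap.fst K A M) ((R.semidirect N).polyMul x y) =
      R.polyMul (LinearMap.rTensor K[X] (LinearMap.fst K A M) x)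
        (LinearMap.rTensor K[X] (LinearMap.fst K A M) y) := by
  have : (R.semidirect N).polyMul.compr₂ (LinearMap.rTensor K[X] (LinearMap.fst K A M)) =
      R.polyMul.compl₁₂ (LinearMap.rTensor K[X] (LinearMap.fst K A M))
        (LinearMap.rTensor K[X] (LinearMap.fst K A M)) :=
    polyBilin_ext fun a p m q => by simp [DGAlg.semidirect]
  exact LinearMap.congr_fun₂ this x y

theorem snd_polyMul (x y : (A × M) ⊗[K] K[X]) :
    LinearMap.rTensor K[X] (LinearMap.snd K A M) ((R.semidirect N).polyMul x y) =
      N.polyAct (LinearMap.rTensor K[X] (LinearMap.fst K A M) x)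
        (LinearMap.rTensor K[X] (LinearMap.snd K A M) y) := by
  have : (R.semidirect N).polyMul.compr₂ (LinearMap.rTensor K[X] (LinearMap.snd K A M)) =
      N.polyAct.compl₁₂ (LinearMap.rTensor K[X] (LinearMap.fst K A M))
        (LinearMap.rTensor K[X] (LinearMap.snd K A M)) :=
    polyBilin_ext fun a p m q => by simp [DGAlg.semidirect]
  exact LinearMap.congr_fun₂ this x y

/-! ### The operations of the bar construction in components -/

/-- In degree i of B[1] the function part has coefficients of degree i + 1, while the coefficients
of dt have degree i. So the sign of B[1] differs from the coefficient sign only on the function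
part. -/
theorem fiber_sgn_coe (b : fiberSub K A M) :
    (((fiberAlg R N).shift 1).sgn b).1 =
      (-(R.semidirect N).polySgn b.1.1, (R.semidirect N).polySgn b.1.2) := by
  have : Submodule.subtype _ ∘ₗ ((fiberAlg R N).shift 1).sgn =
      (LinearMap.prodMap (-(R.semidirect N).polySgn) (R.semidirect N).polySgn) ∘ₗ
        Submodule.subtype _ :=
    ((fiberAlg R N).shift 1).hom_ext fun i v hv => by
      rw [LinearMap.comp_apply, ((fiberAlg R N).shift 1).sgn_of_mem hv]
      have h1 := DGAlg.polySgn_of_mem (R.semidirect N).toDGVec (i := 1 + i) (x := v.1.1) hv.1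
      have h2 := DGAlg.polySgn_of_mem (R.semidirect N).toDGVec (i := 1 + i - 1)
        (x := v.1.2) hv.2
      rw [add_sub_cancel_left] at h2
      rw [zpow_add₀ (by simp : (-1 : K) ≠ 0), zpow_one, neg_one_mul] at h1
      have h3 : ((-1 : K) ^ i) • v.1.1 = -(R.semidirect N).polySgn v.1.1 := by
        refine eq_neg_of_add_eq_zero_left ?_
        rw [h1, ← add_smul, add_neg_cancel, zero_smul]
      refine Prod.ext ?_ ?_
      · exact h3
      · exact h2.symm
  exact LinearMap.congr_fun this b

theorem dtA_sgn (b : fiberSub K A M) :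
    dtA K A M (((fiberAlg R N).shift 1).sgn b) = R.polySgn (dtA K A M b) := by
  simp only [dtA, LinearMap.comp_apply, Submodule.subtype_apply, LinearMap.snd_apply,
    fiber_sgn_coe]
  exact fst_polySgn N _

theorem dtA_d (b : fiberSub K A M) :
    dtA K A M ((fiberAlg R N).barQ₁ b) =
      R.polySgn (LinearMap.lTensor A (Polynomial.derivative (R := K)) (fnA K A M b)) +
        LinearMap.rTensor K[X] R.d (dtA K A M b) := by
  change LinearMap.rTensor K[X] (LinearMap.fst K A M)
    (TensorProduct.map (R.semidirect N).sgn (Polynomial.derivative (R := K)) b.1.1 +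
      LinearMap.rTensor K[X] (R.semidirect N).d b.1.2) = _
  rw [map_add, map_sgn_eq, fst_polySgn, fst_polyD]
  congr 2
  exact LinearMap.congr_fun ((LinearMap.rTensor_comp_lTensor _ _ _).trans
    (LinearMap.lTensor_comp_rTensor _ _ _).symm) b.1.1

theorem dtM_d (b : fiberSub K A M) :
    dtM K A M ((fiberAlg R N).barQ₁ b) =
      N.polySgn (LinearMap.lTensor M (Polynomial.derivative (R := K)) (fnM K A M b)) +
        LinearMap.rTensor K[X] N.d (dtM K A M b) := by
  change LinearMap.rTensor K[X] (LinearMap.snd K A M)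
    (TensorProduct.map (R.semidirect N).sgn (Polynomial.derivative (R := K)) b.1.1 +
      LinearMap.rTensor K[X] (R.semidirect N).d b.1.2) = _
  rw [map_add, map_sgn_eq, snd_polySgn, snd_polyD]
  congr 2
  exact LinearMap.congr_fun ((LinearMap.rTensor_comp_lTensor _ _ _).trans
    (LinearMap.lTensor_comp_rTensor _ _ _).symm) b.1.1

theorem barQ₂_coe_snd (b c : fiberSub K A M) :
    ((fiberAlg R N).barQ₂ b c).1.2 =
      -(R.semidirect N).polyMul ((R.semidirect N).polySgn b.1.1) c.1.2 +
        (R.semidirect N).polyMul ((R.semidirect N).polySgn b.1.2)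
          ((R.semidirect N).polySgn c.1.1) := by
  change (R.semidirect N).polyMul (((fiberAlg R N).shift 1).sgn b).1.1 c.1.2 +
    (R.semidirect N).polyMul (((fiberAlg R N).shift 1).sgn b).1.2
      ((R.semidirect N).polySgn c.1.1) = _
  rw [fiber_sgn_coe, map_neg, LinearMap.neg_apply]

theorem dtA_barQ₂ (b c : fiberSub K A M) :
    dtA K A M ((fiberAlg R N).barQ₂ b c) =
      -R.polyMul (R.polySgn (fnA K A M b)) (dtA K A M c) +
        R.polyMul (R.polySgn (dtA K A M b)) (R.polySgn (fnA K A M c)) := by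
  simp only [dtA, fnA, LinearMap.comp_apply, Submodule.subtype_apply, LinearMap.snd_apply,
    LinearMap.fst_apply, barQ₂_coe_snd, map_add, map_neg, fst_polyMul, fst_polySgn]

/-- The M-components of `b` do not occur because (a,m)(b,n) = (ab,an). The sign on `fnM` of `c`
comes from moving dt past it. -/
theorem dtM_barQ₂ (b c : fiberSub K A M) :
    dtM K A M ((fiberAlg R N).barQ₂ b c) =
      -N.polyAct (R.polySgn (fnA K A M b)) (dtM K A M c) +
        N.polyAct (R.polySgn (dtA K A M b)) (N.polySgn (fnM K A M c)) := by
  simp only [dtA, fnA, dtM, fnM, LinearMap.comp_apply, Submodule.subtype_apply,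
    LinearMap.snd_apply, LinearMap.fst_apply, barQ₂_coe_snd, map_add, map_neg, snd_polyMul,
    fst_polySgn, snd_polySgn]

theorem polyMul_polyAct (x y : A ⊗[K] K[X]) (z : M ⊗[K] K[X]) :
    N.polyAct (R.polyMul x y) z = N.polyAct x (N.polyAct y z) := by
  induction x using TensorProduct.induction_on with
  | zero => simp
  | add x x' hx hx' => simp only [map_add, LinearMap.add_apply, hx, hx']
  | tmul a p =>
    induction y using TensorProduct.induction_on with
    | zero => simp
    | add y y' hy hy' => simp only [map_add, LinearMap.add_apply, hy, hy']
    | tmul b q =>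
      induction z using TensorProduct.induction_on with
      | zero => simp
      | add z z' hz hz' => simp only [map_add, hz, hz']
      | tmul c r => simp [N.mul_act, mul_assoc]

/-! ### The iterated integrals over `t ≤ t₁ ≤ ⋯ ≤ tₙ ≤ 1` -/

/-- The polynomial in `t` given by the integral over `t ≤ t₀ ≤ ⋯ ≤ tₙ ≤ 1` of the
`dt₀ ⋯ dtₙ`-component of `b₀ ⋯ bₙ`, with values in `M`. -/
def upperInt : (n : ℕ) → MultilinearMap K (fun _ : Fin (n + 1) => fiberSub K A M) (M ⊗[K] K[X])
  | 0 => LinearMap.uncurryLeft (M := fun _ : Fin 1 => fiberSub K A M)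
      { toFun := fun b => MultilinearMap.constOfIsEmpty K _ (polyCoprim K M (dtM K A M b))
        map_add' := fun b c => by ext; simp
        map_smul' := fun r b => by ext; simp }
  | n + 1 => LinearMap.uncurryLeft (M := fun _ : Fin (n + 2) => fiberSub K A M)
      { toFun := fun b =>
          (polyCoprim K M ∘ₗ N.polyAct (dtA K A M b)).compMultilinearMap (upperInt n)
        map_add' := fun b c => by ext; simp
        map_smul' := fun r b => by ext; simp }

theorem upperInt_zero (b : Fin 1 → fiberSub K A M) :
    upperInt N 0 b = polyCoprim K M (dtM K A M (b 0)) := rfl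

theorem upperInt_succ (n : ℕ) (b : Fin (n + 2) → fiberSub K A M) :
    upperInt N (n + 1) b =
      polyCoprim K M (N.polyAct (dtA K A M (b 0)) (upperInt N n (Fin.tail b))) := rfl

/-- The coefficient of `dt₀` in the integrand of `upperInt`. -/
def upperIntegrand : (n : ℕ) → (Fin (n + 1) → fiberSub K A M) → M ⊗[K] K[X]
  | 0, b => dtM K A M (b 0)
  | n + 1, b => N.polyAct (dtA K A M (b 0)) (upperInt N n (Fin.tail b))

theorem upperInt_eq (n : ℕ) (b : Fin (n + 1) → fiberSub K A M) :
    upperInt N n b = polyCoprim K M (upperIntegrand N n b) := by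
  cases n <;> rfl

/-- The boundary term at `t₀ = t`, up to sign. -/
def upperBoundary : (n : ℕ) → (Fin (n + 1) → fiberSub K A M) → M ⊗[K] K[X]
  | 0, b => N.polySgn (fnM K A M (b 0))
  | n + 1, b => N.polyAct (R.polySgn (fnA K A M (b 0))) (upperInt N n (Fin.tail b))

/-- The boundary term has a factor m(t) for a one-letter word and a(t) for a longer one, and
elements of B(A,M) satisfy m(0) = 0 and a(0) = 0. -/
theorem polyEval_upperBoundary (n : ℕ) (b : Fin (n + 1) → fiberSub K A M) :
    polyEval K M 0 (upperBoundary N n b) = 0 := by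
  cases n with
  | zero =>
    rw [upperBoundary, polySgn, polyEval_rTensor, polyEval_zero_fnM, map_zero]
  | succ n =>
    rw [upperBoundary, N.polyEval_polyAct, polySgn, polyEval_rTensor, polyEval_zero_fnA,
      map_zero, map_zero, LinearMap.zero_apply]

/-- A product of the first two letters has a dt from either factor. The term with dt from the second
completes a total derivative in Stokes' formula; the term with dt from the first cancels the
boundary term of the tail. -/
theorem upperIntegrand_merge_zero (n : ℕ) (b : Fin (n + 2) → fiberSub K A M) :
    upperIntegrand N n (RedTensor.mergeFun ((fiberAlg R N).shift 1).sgn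
        (fiberAlg R N).barQ₂ 0 b) =
      -N.polyAct (R.polySgn (fnA K A M (b 0))) (upperIntegrand N n (Fin.tail b)) +
        N.polyAct (R.polySgn (dtA K A M (b 0))) (upperBoundary N n (Fin.tail b)) := by
  have h0 : RedTensor.mergeFun ((fiberAlg R N).shift 1).sgn (fiberAlg R N).barQ₂ 0 b 0 =
      (fiberAlg R N).barQ₂ (b 0) (b 1) := by simp [RedTensor.mergeFun]
  cases n with
  | zero => rw [upperIntegrand, h0, dtM_barQ₂]; rfl
  | succ n =>
    have ht : Fin.tail (RedTensor.mergeFun ((fiberAlg R N).shift 1).sgn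
        (fiberAlg R N).barQ₂ 0 b) = Fin.tail (Fin.tail b) := by
      funext j
      simp [Fin.tail, RedTensor.mergeFun, Fin.succ_ne_zero]
    rw [upperIntegrand, h0, ht, dtA_barQ₂, map_add, map_neg, LinearMap.add_apply,
      LinearMap.neg_apply, polyMul_polyAct, polyMul_polyAct]
    rfl

/-- The letters `s v₀, …, s vᵢ₋₁, f vᵢ, vᵢ₊₁, …, vₙ`. -/
def applyFun {V : Type*} [AddCommGroup V] [Module K V] {n : ℕ} (s f : V →ₗ[K] V) (i : Fin n)
    (v : Fin n → V) (j : Fin n) : V :=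
  (if j < i then s else if j = i then f else LinearMap.id) (v j)

/-- The sum of the terms of `upperInt` over the coderivation induced by `q₁`. -/
def upperSum₁ (n : ℕ) (b : Fin (n + 1) → fiberSub K A M) : M ⊗[K] K[X] :=
  ∑ i, upperInt N n (applyFun ((fiberAlg R N).shift 1).sgn (fiberAlg R N).barQ₁ i b)

/-- The sum of the terms of `upperInt` over the coderivation induced by `q₂`. -/
def upperSum₂ : (n : ℕ) → (Fin (n + 1) → fiberSub K A M) → M ⊗[K] K[X]
  | 0, _ => 0
  | n + 1, b => ∑ i, upperInt N n
      (RedTensor.mergeFun ((fiberAlg R N).shift 1).sgn (fiberAlg R N).barQ₂ i b)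

/-- Either q₁ acts on the first letter, or it passes that letter, leaving its sign, and acts on the
tail. This and its analogue for q₂ set up the induction for Stokes' formula. -/
theorem upperSum₁_succ (n : ℕ) (b : Fin (n + 2) → fiberSub K A M) :
    upperSum₁ N (n + 1) b =
      polyCoprim K M (N.polyAct (dtA K A M ((fiberAlg R N).barQ₁ (b 0)))
        (upperInt N n (Fin.tail b))) +
      polyCoprim K M (N.polyAct (R.polySgn (dtA K A M (b 0)))
        (upperSum₁ N n (Fin.tail b))) := by
  rw [upperSum₁, Fin.sum_univ_succ]
  congr 1
  rw [upperSum₁, map_sum (N.polyAct _), map_sum (polyCoprim K M)]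
  refine Finset.sum_congr rfl fun i _ => ?_
  rw [upperInt_succ]
  have h0 : applyFun ((fiberAlg R N).shift 1).sgn (fiberAlg R N).barQ₁ i.succ b 0 =
      ((fiberAlg R N).shift 1).sgn (b 0) := by simp [applyFun, Fin.succ_pos]
  have ht : Fin.tail (applyFun ((fiberAlg R N).shift 1).sgn (fiberAlg R N).barQ₁ i.succ b) =
      applyFun ((fiberAlg R N).shift 1).sgn (fiberAlg R N).barQ₁ i (Fin.tail b) := by
    funext j
    simp [Fin.tail, applyFun]
  rw [h0, ht, dtA_sgn]

theorem upperSum₂_succ (n : ℕ) (b : Fin (n + 2) → fiberSub K A M) :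
    upperSum₂ N (n + 1) b =
      polyCoprim K M (upperIntegrand N n (RedTensor.mergeFun ((fiberAlg R N).shift 1).sgn
        (fiberAlg R N).barQ₂ 0 b)) +
      polyCoprim K M (N.polyAct (R.polySgn (dtA K A M (b 0)))
        (upperSum₂ N n (Fin.tail b))) := by
  rw [upperSum₂, Fin.sum_univ_succ, upperInt_eq]
  congr 1
  cases n with
  | zero => simp [upperSum₂]
  | succ n =>
    rw [upperSum₂, map_sum, map_sum]
    refine Finset.sum_congr rfl fun i _ => ?_
    rw [upperInt_succ]
    have h0 : RedTensor.mergeFun ((fiberAlg R N).shift 1).sgn (fiberAlg R N).barQ₂ i.succ b 0 =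
        ((fiberAlg R N).shift 1).sgn (b 0) := by simp [RedTensor.mergeFun, Fin.succ_pos]
    have ht : Fin.tail (RedTensor.mergeFun ((fiberAlg R N).shift 1).sgn
        (fiberAlg R N).barQ₂ i.succ b) =
        RedTensor.mergeFun ((fiberAlg R N).shift 1).sgn (fiberAlg R N).barQ₂ i
          (Fin.tail b) := by
      funext j
      simp [Fin.tail, RedTensor.mergeFun]
    rw [h0, ht, dtA_sgn]

/-- Stokes' formula: the iterated integrals of the bar differential of `b₀ ⊗ ⋯ ⊗ bₙ`. -/
theorem upperSum_eq [CharZero K] (n : ℕ) (b : Fin (n + 1) → fiberSub K A M) :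
    upperSum₁ N n b + upperSum₂ N n b =
      LinearMap.rTensor K[X] N.d (upperInt N n b) - upperBoundary N n b := by
  induction n with
  | zero =>
    have h0 : applyFun ((fiberAlg R N).shift 1).sgn (fiberAlg R N).barQ₁ 0 b 0 =
        (fiberAlg R N).barQ₁ (b 0) := by simp [applyFun]
    -- Since m(1) = 0, the integral of m′ from t to 1 is -m(t), the boundary term up to its sign
    -- operator.
    rw [upperSum₁, upperSum₂, upperBoundary, Fin.sum_univ_one, upperInt_zero, upperInt_zero,
      h0, dtM_d, map_add, polySgn_lTensor, polyCoprim_derivative, polySgn, polyEval_rTensor,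
      polyEval_one_fnM, rTensor_polyCoprim, map_zero, TensorProduct.zero_tmul]
    abel
  | succ n ih =>
    -- Integration by parts for ε(a₀) acting on I, with a₀ the function part of the first letter and
    -- I the integral of the tail; I(1) = 0 leaves only the endpoint t.
    have hder := N.polyDer_polyAct (R.polySgn (fnA K A M (b 0))) (upperInt N n (Fin.tail b))
    have hI := congrArg (polyCoprim K M) hder
    rw [polyCoprim_derivative, N.polyEval_polyAct] at hI
    have h1 : polyEval K M 1 (upperInt N n (Fin.tail b)) = 0 := by
      rw [upperInt_eq, polyEval_one_polyCoprim]
    rw [h1, map_zero, TensorProduct.zero_tmul, zero_sub, upperInt_eq N n (Fin.tail b),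
      derivative_polyCoprim, ← upperInt_eq, map_neg, map_add, map_neg] at hI
    -- The boundary term of the tail supplied by `ih` cancels against the merge; the terms in a₀ and
    -- a₀′ combine by `hI` to the new boundary term; the rest is the Leibniz rule for d.
    rw [upperSum₁_succ, upperSum₂_succ, upperIntegrand_merge_zero, add_add_add_comm,
      ← map_add (polyCoprim K M) (N.polyAct _ (upperSum₁ N n _)),
      ← map_add (N.polyAct _) (upperSum₁ N n _), ih, dtA_d,
      upperInt_succ N n b, rTensor_polyCoprim, N.polyD_polyAct, polySgn_lTensor, upperBoundary,
      ← neg_neg (N.polyAct (R.polySgn (fnA K A M (b 0))) (upperInt N n (Fin.tail b))), hI]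
    simp only [map_add, map_neg, map_sub, LinearMap.add_apply]
    abel

end FiberParts

/-! ### The map ∫_∞: existence, uniqueness and structure equations -/

section IterIntegralMap

variable {K A M : Type*} [Field K] [AddCommGroup A] [Module K A] [AddCommGroup M] [Module K M]
  {R : DGAlg K A} (N : DGMod R M)

open DGVec

/-- The map `∫_∞`. -/
def iterIntegralMap : RedTensor K (fiberSub K A M) →ₗ[K] M :=
  DirectSum.toModule K ℕ M fun n => polyEval K M 0 ∘ₗ PiTensorProduct.lift (upperInt N n)

theorem iterIntegralMap_word (n : ℕ) (b : Fin (n + 1) → fiberSub K A M) :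
    iterIntegralMap N (RedTensor.word b) = polyEval K M 0 (upperInt N n b) := by
  rw [iterIntegralMap, RedTensor.word, DirectSum.toModule_lof, LinearMap.comp_apply,
    PiTensorProduct.lift.tprod]

theorem tail_snoc {α : Type*} {n : ℕ} (f : Fin (n + 1) → α) (x : α) :
    Fin.tail (Fin.snoc (α := fun _ => α) f x) = Fin.snoc (α := fun _ => α) (Fin.tail f) x := by
  conv_lhs => rw [← Fin.cons_self_tail f, ← Fin.cons_snoc_eq_snoc_cons, Fin.tail_cons]

theorem snoc_apply_zero_of_pos {α : Type*} {n : ℕ} (f : Fin (n + 1) → α) (x : α) :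
    Fin.snoc (α := fun _ => α) f x 0 = f 0 :=
  Fin.snoc_castSucc (α := fun _ => α) x f 0

theorem dtA_fiberDt (x : A × M) (q : K[X]) : dtA K A M (fiberDt x q) = x.1 ⊗ₜ q := by
  simp [dtA, fiberDt]

theorem dtM_fiberDt (x : A × M) (q : K[X]) : dtM K A M (fiberDt x q) = x.2 ⊗ₜ q := by
  simp [dtM, fiberDt]

theorem upperInt_fiberDt (n : ℕ) (a : Fin n → A) (q : Fin n → K[X]) (m : M) (p : K[X]) :
    upperInt N n (Fin.snoc (α := fun _ => fiberSub K A M)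
        (fun i => fiberDt (a i, 0) (q i)) (fiberDt (0, m) p)) =
      actProd N a m ⊗ₜ (List.ofFn (Fin.snoc (α := fun _ => K[X]) q p)).foldr
        (fun r s => coprimitive K (r * s)) 1 := by
  induction n with
  | zero =>
    have h : Fin.snoc (α := fun _ => fiberSub K A M)
        (fun i : Fin 0 => fiberDt (a i, 0) (q i)) (fiberDt (0, m) p) 0 = fiberDt (0, m) p := by
      exact Fin.snoc_last (α := fun _ => fiberSub K A M) _ _
    have h' : Fin.snoc (α := fun _ => K[X]) q p 0 = p :=
      Fin.snoc_last (α := fun _ => K[X]) _ _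
    rw [upperInt_zero, h, dtM_fiberDt]
    simp [actProd, h']
  | succ n ih =>
    have hq : (fun i : Fin (n + 1) => Fin.snoc (α := fun _ => K[X]) q p i.succ) =
        Fin.snoc (α := fun _ => K[X]) (Fin.tail q) p := tail_snoc q p
    rw [upperInt_succ, snoc_apply_zero_of_pos, tail_snoc, dtA_fiberDt, List.ofFn_succ, hq,
      snoc_apply_zero_of_pos]
    have := ih (Fin.tail a) (Fin.tail q)
    erw [this]
    simp [actProd]
    rfl

/-- The integral sees only the A-coefficient of dt in each letter before the last and the
M-coefficient of dt in the last, and is linear in each. -/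
theorem upperInt_eq_zero (n : ℕ) (b : Fin (n + 1) → fiberSub K A M)
    (h : (∃ i : Fin n, dtA K A M (b i.castSucc) = 0) ∨ dtM K A M (b (Fin.last n)) = 0) :
    upperInt N n b = 0 := by
  induction n with
  | zero =>
    rcases h with ⟨i, -⟩ | h
    · exact i.elim0
    · rw [upperInt_zero]
      erw [h]
      rw [map_zero]
  | succ n ih =>
    rw [upperInt_succ]
    rcases h with ⟨i, h⟩ | h
    · induction i using Fin.cases with
      | zero => rw [show b 0 = b (Fin.castSucc 0) from rfl, h]; simp
      | succ i => rw [ih (Fin.tail b) (Or.inl ⟨i, h⟩)]; simp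
    · rw [ih (Fin.tail b) (Or.inr h)]; simp

theorem dtA_eq_zero {c : FiberPart} {b : fiberSub K A M} (hb : b ∈ fiberPart K A M c)
    (hc : c ≠ .R1) : dtA K A M b = 0 := by
  cases c with
  | R0 => simp [dtA, hb.1]
  | R1 => exact absurd rfl hc
  | S0 => simp [dtA, hb.1]
  | S1 => exact hb.2

theorem dtM_eq_zero {c : FiberPart} {b : fiberSub K A M} (hb : b ∈ fiberPart K A M c)
    (hc : c ≠ .S1) : dtM K A M b = 0 := by
  cases c with
  | R0 => simp [dtM, hb.1]
  | R1 => exact hb.2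
  | S0 => simp [dtM, hb.1]
  | S1 => exact absurd rfl hc

theorem isIterIntegralMap_iterIntegralMap [CharZero K] :
    IsIterIntegralMap N (iterIntegralMap N) where
  map_dt n a q m p := by
    rw [iterIntegralMap_word, upperInt_fiberDt, polyEval_tmul, iterIntegral_eq_foldr]
  map_other n c b hb hc := by
    rw [iterIntegralMap_word, upperInt_eq_zero, map_zero]
    by_contra! h
    refine hc ⟨fun i => ?_, ?_⟩
    · by_contra hi
      exact h.1 i (dtA_eq_zero (hb _) hi)
    · by_contra hi
      exact h.2 (dtM_eq_zero (hb _) hi)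

/-! ### Uniqueness -/

/-- Elements of the four summands, those of `R₁` and `S₁` being of the form `x q(t)dt`. -/
def simpleFiber (K A M : Type*) [Field K] [AddCommGroup A] [Module K A] [AddCommGroup M]
    [Module K M] : Set (fiberSub K A M) :=
  {b | ∃ c : FiberPart, b ∈ fiberPart K A M c ∧ (c = .R1 → ∃ a q, b = fiberDt (a, 0) q) ∧
    (c = .S1 → ∃ m p, b = fiberDt (0, m) p)}

theorem rTensor_inl_fst_add (x : (A × M) ⊗[K] K[X]) :
    LinearMap.rTensor K[X] (LinearMap.inl K A M ∘ₗ LinearMap.fst K A M) x +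
      LinearMap.rTensor K[X] (LinearMap.inr K A M ∘ₗ LinearMap.snd K A M) x = x := by
  have h : LinearMap.inl K A M ∘ₗ LinearMap.fst K A M +
      LinearMap.inr K A M ∘ₗ LinearMap.snd K A M = LinearMap.id := by ext <;> simp
  rw [← LinearMap.add_apply, ← LinearMap.rTensor_add, h, LinearMap.rTensor_id, LinearMap.id_apply]

theorem fiberDt_mem_span (v : (A × M) ⊗[K] K[X]) :
    (⟨(0, v), by simp [fiberSub]⟩ : fiberSub K A M) ∈
      Submodule.span K (simpleFiber K A M) := by
  induction v using TensorProduct.induction_on with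
  | zero => exact Submodule.zero_mem _
  | tmul x q =>
    have e : (⟨(0, x ⊗ₜ q), by simp [fiberSub]⟩ : fiberSub K A M) =
        fiberDt (x.1, 0) q + fiberDt (0, x.2) q := by
      refine Subtype.ext (Prod.ext (by simp [fiberDt]) ?_)
      simp [fiberDt, ← TensorProduct.add_tmul]
    rw [e]
    refine Submodule.add_mem _ (Submodule.subset_span ⟨.R1, ?_, ?_, ?_⟩)
      (Submodule.subset_span ⟨.S1, ?_, ?_, ?_⟩)
    · exact ⟨rfl, by simp [fiberDt]⟩
    · exact fun _ => ⟨_, _, rfl⟩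
    · exact fun h => by cases h
    · exact ⟨rfl, by simp [fiberDt]⟩
    · exact fun h => by cases h
    · exact fun _ => ⟨_, _, rfl⟩
  | add x y hx hy =>
    have := Submodule.add_mem _ hx hy
    convert this using 1
    exact Subtype.ext (Prod.ext (add_zero 0).symm rfl)

theorem span_simpleFiber : Submodule.span K (simpleFiber K A M) = ⊤ := by
  rw [eq_top_iff]
  rintro ⟨⟨u, v⟩, hu⟩ -
  obtain ⟨h1, h2, h3⟩ := hu
  -- The boundary conditions constrain the A- and M-components separately, so each component of the
  -- function part again lies in B(A,M).
  let x : fiberSub K A M :=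
    ⟨(LinearMap.rTensor K[X] (LinearMap.inl K A M ∘ₗ LinearMap.fst K A M) u, 0), by
      refine ⟨?_, ?_, ?_⟩ <;> simp only [polyEval_rTensor] <;> simp
      exact h1⟩
  let y : fiberSub K A M :=
    ⟨(LinearMap.rTensor K[X] (LinearMap.inr K A M ∘ₗ LinearMap.snd K A M) u, 0), by
      refine ⟨?_, ?_, ?_⟩ <;> simp only [polyEval_rTensor] <;> simp
      · exact h2
      · exact h3⟩
  have e : (⟨(u, v), h1, h2, h3⟩ : fiberSub K A M) =
      (x + y) + ⟨(0, v), by simp [fiberSub]⟩ := by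
    refine Subtype.ext (Prod.ext ?_ ?_)
    · change u = _ + _ + 0
      rw [rTensor_inl_fst_add, add_zero]
    · change v = 0 + 0 + v
      simp
  rw [e]
  refine Submodule.add_mem _ (Submodule.add_mem _ (Submodule.subset_span ⟨.R0, ⟨rfl, ?_⟩, ?_, ?_⟩)
    (Submodule.subset_span ⟨.S0, ⟨rfl, ?_⟩, ?_, ?_⟩)) (fiberDt_mem_span v)
  · change LinearMap.rTensor _ _ (LinearMap.rTensor _ _ u) = 0
    rw [← LinearMap.comp_apply, ← LinearMap.rTensor_comp, ← LinearMap.comp_assoc]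
    simp
  · exact fun h => by cases h
  · exact fun h => by cases h
  · change LinearMap.rTensor _ _ (LinearMap.rTensor _ _ u) = 0
    rw [← LinearMap.comp_apply, ← LinearMap.rTensor_comp, ← LinearMap.comp_assoc]
    simp
  · exact fun h => by cases h
  · exact fun h => by cases h

variable {N} in
theorem IsIterIntegralMap.unique {F G : RedTensor K (fiberSub K A M) →ₗ[K] M}
    (hF : IsIterIntegralMap N F) (hG : IsIterIntegralMap N G) : F = G := by
  suffices h : ∀ (n : ℕ) (b : Fin (n + 1) → fiberSub K A M), (∀ i, b i ∈ simpleFiber K A M) →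
      F (RedTensor.word b) = G (RedTensor.word b) from
    -- On each tensor power both maps are multilinear in the letters, so it suffices to compare them
    -- on a basis chosen inside the spanning set `simpleFiber`.
    DirectSum.linearMap_ext K fun n => PiTensorProduct.ext <| Module.Basis.ext_multilinear
      (fun _ => Module.Basis.ofSpan (span_simpleFiber (K := K) (A := A) (M := M)).ge)
      fun v => h n _ fun i => Module.Basis.ofSpan_subset _ ⟨v i, rfl⟩
  intro n b hb
  choose c hc hR hS using hb
  by_cases h : (∀ i : Fin n, c i.castSucc = .R1) ∧ c (Fin.last n) = .S1
  · choose a q haq using fun i => hR _ (h.1 i)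
    obtain ⟨m, p, hmp⟩ := hS _ h.2
    have e : b = Fin.snoc (α := fun _ => fiberSub K A M)
        (fun i => fiberDt (a i, 0) (q i)) (fiberDt (0, m) p) := by
      funext i
      induction i using Fin.lastCases with
      | last => rw [hmp, Fin.snoc_last]
      | cast i => rw [haq, Fin.snoc_castSucc]
    rw [e, hF.map_dt, hG.map_dt]
  · rw [hF.map_other n c b hc h, hG.map_other n c b hc h]

/-! ### The structure equations -/

theorem iterIntegralMap_barD (n : ℕ) (b : Fin (n + 1) → fiberSub K A M) :
    iterIntegralMap N ((fiberAlg R N).barD (RedTensor.word b)) =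
      polyEval K M 0 (upperSum₁ N n b + upperSum₂ N n b) := by
  rw [DGAlg.barD, LinearMap.add_apply, map_add, map_add]
  congr 1
  · rw [RedTensor.coder₁, RedTensor.word, DirectSum.toModule_lof, LinearMap.sum_apply, map_sum,
      upperSum₁, map_sum]
    refine Finset.sum_congr rfl fun i _ => ?_
    rw [LinearMap.comp_apply, RedTensor.applyAt, PiTensorProduct.map_tprod]
    exact iterIntegralMap_word N n _
  · rw [RedTensor.coder₂, RedTensor.word, DirectSum.toModule_lof]
    cases n with
    | zero => simp [upperSum₂]
    | succ n =>
      dsimp only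
      rw [LinearMap.sum_apply, map_sum, upperSum₂, map_sum]
      refine Finset.sum_congr rfl fun i _ => ?_
      rw [LinearMap.comp_apply, RedTensor.merge, PiTensorProduct.lift.tprod]
      exact iterIntegralMap_word N n _

/-- The shift by 1 absorbs the degree of dt: a letter of degree e in B[1] has dt-coefficients of
degree e, and integration in t preserves coefficient degrees. -/
theorem upperInt_mem (n : ℕ) (e : Fin (n + 1) → ℤ) (b : Fin (n + 1) → fiberSub K A M)
    (hb : ∀ i, b i ∈ ((fiberAlg R N).shift 1).gr (e i)) :
    upperInt N n b ∈ N.polyGr (∑ i, e i) := by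
  have hdt : ∀ i, (b i).1.2 ∈ (R.semidirect N).polyGr (e i) := fun i => by
    have := (hb i).2
    rwa [add_sub_cancel_left] at this
  have hA : ∀ i, dtA K A M (b i) ∈ R.polyGr (e i) := fun i =>
    (R.semidirect N).map_polyGr R.toDGVec (LinearMap.fst K A M) LinearMap.id
      (fun v hv => hv.1) (hdt i)
  have hM : ∀ i, dtM K A M (b i) ∈ N.polyGr (e i) := fun i =>
    (R.semidirect N).map_polyGr N.toDGVec (LinearMap.snd K A M) LinearMap.id
      (fun v hv => hv.2) (hdt i)
  clear hdt
  induction n with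
  | zero =>
    rw [upperInt_zero, Fin.sum_univ_one]
    exact N.lTensor_mem_polyGr _ (hM 0)
  | succ n ih =>
    rw [upperInt_succ, Fin.sum_univ_succ]
    exact N.lTensor_mem_polyGr _ (N.polyAct_mem (hA 0)
      (ih (Fin.tail e) (Fin.tail b) (fun i => hb _) (fun i => hA _) (fun i => hM _)))

theorem isAInfinityMorphism_iterIntegralMap [CharZero K] :
    DGAlg.IsAInfinityMorphism (fiberAlg R N) (DGAlg.trivial (N.toDGVec.shift (-1)))
      (iterIntegralMap N) where
  map_mem n e b hb := by
    rw [iterIntegralMap_word]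
    change _ ∈ N.gr (-1 + (1 + ∑ i, e i))
    rw [neg_add_cancel_left]
    exact N.polyEval_mem 0 (upperInt_mem N n e b hb)
  map_barD n b := by
    -- Stokes' formula at t = 0; the quadratic terms on the right vanish because the target has
    -- trivial product.
    rw [iterIntegralMap_barD, upperSum_eq, map_sub, polyEval_upperBoundary, sub_zero,
      polyEval_rTensor, iterIntegralMap_word, Finset.sum_eq_zero, add_zero]
    · rfl
    · intro i _
      simp [DGAlg.barQ₂, DGAlg.trivial]

/-! ### The linear part -/

theorem linearPart_iterIntegralMap (b : fiberSub K A M) :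
    DGAlg.linearPart (iterIntegralMap N) b = polyEval K M 0 (polyCoprim K M (dtM K A M b)) :=
  iterIntegralMap_word N 0 _

/-- The morphism of complexes `B(A,M)[1] → M[-1][1]`. -/
def linearPartHom [CharZero K] :
    Hom ((fiberAlg R N).shift 1) ((DGAlg.trivial (N.toDGVec.shift (-1))).shift 1) where
  toLin := DGAlg.linearPart (iterIntegralMap N)
  map_mem i v hv := by
    have := (isAInfinityMorphism_iterIntegralMap N).map_mem 0 (fun _ => i) (fun _ => v)
      (fun _ => hv)
    rwa [Fin.sum_univ_one] at this
  comm v := by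
    have := (isAInfinityMorphism_iterIntegralMap N).map_barD 0 (fun _ => v)
    have h0 : applyFun ((fiberAlg R N).shift 1).sgn (fiberAlg R N).barQ₁ 0
        (fun _ : Fin (0 + 1) => v) 0 = (fiberAlg R N).d v := by simp [applyFun]; rfl
    rw [iterIntegralMap_barD, upperSum₁, upperSum₂, Fin.sum_univ_one, add_zero, upperInt_zero,
      h0, Fin.sum_univ_zero, add_zero] at this
    exact (linearPart_iterIntegralMap N _).trans this

end IterIntegralMap

/-! ### The linear part is a quasi-isomorphism -/

section QuasiIso

variable {K V W A M : Type*} [Field K] [AddCommGroup V] [Module K V] [AddCommGroup W]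
  [Module K W] [AddCommGroup A] [Module K A] [AddCommGroup M] [Module K M]

open DGVec

theorem DGVec.sgn_sgn (C : DGVec K V) (v : V) : C.sgn (C.sgn v) = v := by
  have h := congrArg (polyEval K V 0) (DGAlg.polySgn_polySgn C (v ⊗ₜ 1))
  simpa [polySgn] using h

theorem polyEval_zero_primitive (x : V ⊗[K] K[X]) :
    polyEval K V 0 (LinearMap.lTensor V (primitive K) x) = 0 := by
  rw [polyEval_lTensor 0 0 (primitive K) 0 (fun p => by simp)]
  simp

theorem polyEval_one_primitive (x : V ⊗[K] K[X]) :
    polyEval K V 1 (LinearMap.lTensor V (primitive K) x) =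
      polyEval K V 0 (polyCoprim K V x) :=
  polyEval_lTensor 1 0 _ _ (fun p => by simp) x

/-- This form integrates over A ⊕ M before projecting, so the primitive of a closed form can be
built in (A ⊕ M)[t,dt] without treating the components apart. -/
theorem linearPart_eq_snd {R : DGAlg K A} (N : DGMod R M) (b : fiberSub K A M) :
    DGAlg.linearPart (iterIntegralMap N) b =
      (polyEval K (A × M) 1 (LinearMap.lTensor (A × M) (primitive K) b.1.2)).2 := by
  rw [linearPart_iterIntegralMap, polyEval_one_primitive]
  change _ = LinearMap.snd K A M _
  rw [← polyEval_rTensor, rTensor_polyCoprim]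
  rfl

theorem DGVec.Hom.cohomologyMap_injective {C : DGVec K V} {D : DGVec K W} (f : Hom C D) (i : ℤ)
    (h : ∀ b ∈ C.cocycles i, f.toLin b ∈ D.coboundaries i → b ∈ C.coboundaries i) :
    Function.Injective (f.cohomologyMap i) := by
  rw [injective_iff_map_eq_zero]
  intro u
  induction u using Submodule.Quotient.induction_on with
  | H b =>
    intro hb
    rw [cohomologyMap, Submodule.mapQ_apply, Submodule.Quotient.mk_eq_zero] at hb
    rw [Submodule.Quotient.mk_eq_zero]
    exact h b.1 b.2 hb

theorem DGVec.Hom.cohomologyMap_surjective {C : DGVec K V} {D : DGVec K W} (f : Hom C D) (i : ℤ)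
    (h : ∀ w ∈ D.cocycles i, ∃ b ∈ C.cocycles i, f.toLin b = w) :
    Function.Surjective (f.cohomologyMap i) := by
  intro u
  induction u using Submodule.Quotient.induction_on with
  | H w =>
    obtain ⟨b, hb, hw⟩ := h w.1 w.2
    exact ⟨Submodule.Quotient.mk ⟨b, hb⟩, congrArg Submodule.Quotient.mk (Subtype.ext hw)⟩

variable [CharZero K]

theorem derivative_primitive_lTensor (x : V ⊗[K] K[X]) :
    LinearMap.lTensor V (Polynomial.derivative (R := K)) (LinearMap.lTensor V (primitive K) x) =
      x := by
  induction x using TensorProduct.induction_on with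
  | zero => simp
  | tmul v p => simp
  | add x y hx hy => simp only [map_add, hx, hy]

theorem primitive_derivative_lTensor (x : V ⊗[K] K[X]) :
    LinearMap.lTensor V (primitive K) (LinearMap.lTensor V (Polynomial.derivative (R := K)) x) =
      x - polyEval K V 0 x ⊗ₜ 1 := by
  induction x using TensorProduct.induction_on with
  | zero => simp
  | tmul v p =>
    have h : Polynomial.C (p.eval 0) = p.eval 0 • (1 : K[X]) := by
      rw [Polynomial.smul_eq_C_mul, mul_one]
    simp [primitive_derivative, TensorProduct.tmul_sub, TensorProduct.smul_tmul, h]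
  | add x y hx hy => simp only [map_add, hx, hy, TensorProduct.add_tmul]; abel

/-- A closed form `x + y dt` with `x(0) = 0` is the differential of
`ε(∫₀ᵗ y) - n₂ t + n dt` whenever `n₂ = ε(dn)`. -/
theorem formsD_homotopy (C : DGVec K V) (x y : V ⊗[K] K[X]) (n : V)
    (hd : C.formsD (x, y) = 0) (h0 : polyEval K V 0 x = 0) :
    C.formsD (C.polySgn (LinearMap.lTensor V (primitive K) y) - C.sgn (C.d n) ⊗ₜ Polynomial.X,
      n ⊗ₜ 1) = (x, y) := by
  have hdy : LinearMap.rTensor K[X] C.d y =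
      -C.polySgn (LinearMap.lTensor V (Polynomial.derivative (R := K)) x) := by
    have h : TensorProduct.map C.sgn (Polynomial.derivative (R := K)) x +
      LinearMap.rTensor K[X] C.d y = 0 := congrArg Prod.snd hd
    rw [map_sgn_eq] at h
    exact eq_neg_of_add_eq_zero_right h
  have hcomm : LinearMap.rTensor K[X] C.d (LinearMap.lTensor V (primitive K) y) =
      LinearMap.lTensor V (primitive K) (LinearMap.rTensor K[X] C.d y) :=
    LinearMap.congr_fun ((LinearMap.rTensor_comp_lTensor _ _ _).trans
      (LinearMap.lTensor_comp_rTensor _ _ _).symm) y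
  refine Prod.ext ?_ ?_
  · change LinearMap.rTensor K[X] C.d (C.polySgn (LinearMap.lTensor V (primitive K) y) -
      C.sgn (C.d n) ⊗ₜ Polynomial.X) = x
    have h1 := DGAlg.polySgn_polyD C (LinearMap.lTensor V (primitive K) y)
    have h2 : C.d (C.sgn (C.d n)) = 0 := by
      rw [C.sgn_d, map_neg, C.d_d, neg_zero]
    -- Closedness replaces dy by -ε(x′), and ∫₀ᵗ x′ = x because x(0) = 0.
    rw [map_sub, LinearMap.rTensor_tmul, h2, TensorProduct.zero_tmul, sub_zero,
      ← neg_eq_iff_eq_neg.mpr h1, hcomm, hdy, map_neg, map_neg, neg_neg, polySgn_lTensor,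
      DGAlg.polySgn_polySgn,
      primitive_derivative_lTensor, h0,
      TensorProduct.zero_tmul, sub_zero]
  · change TensorProduct.map C.sgn (Polynomial.derivative (R := K))
      (C.polySgn (LinearMap.lTensor V (primitive K) y) - C.sgn (C.d n) ⊗ₜ Polynomial.X) +
        LinearMap.rTensor K[X] C.d (n ⊗ₜ 1) = y
    -- The linear term contributes -dn to the coefficient of dt, since ε is an involution, and d(n
    -- dt) cancels it.
    rw [map_sub, map_sgn_eq, ← polySgn_lTensor, derivative_primitive_lTensor,
      DGAlg.polySgn_polySgn, TensorProduct.map_tmul, Polynomial.derivative_X, C.sgn_sgn,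
      LinearMap.rTensor_tmul, sub_add_cancel]

variable {R : DGAlg K A} (N : DGMod R M)

theorem linearPartHom_cohomologyMap_injective (i : ℤ) :
    Function.Injective ((linearPartHom N).cohomologyMap i) := by
  refine (linearPartHom N).cohomologyMap_injective i ?_
  rintro b ⟨hb, hd⟩ ⟨n, hn, hnb⟩
  change N.d n = DGAlg.linearPart (iterIntegralMap N) b at hnb
  replace hn : n ∈ N.gr (i - 1) := by
    change n ∈ N.gr (-1 + (1 + (i - 1))) at hn
    rwa [neg_add_cancel_left] at hn
  set C := (R.semidirect N).toDGVec with hC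
  obtain ⟨⟨x, y⟩, h1, h2, h3⟩ := b
  rw [linearPart_eq_snd] at hnb
  have hxy : C.formsD (x, y) = 0 := congrArg Subtype.val (show (fiberAlg R N).d _ = 0 from hd)
  have h0 : polyEval K (A × M) 0 x = 0 := Prod.ext h1 h2
  -- The correction has no A-component, as the A-part of a form in B(A,M) is constrained only at t =
  -- 0.
  have key := formsD_homotopy C x y (0, n) hxy h0
  have hsd : C.sgn (C.d (0, n)) = (0, N.sgn (N.d n)) := by
    have hm : ((0, N.d n) : A × M) ∈ C.gr i :=
      ⟨Submodule.zero_mem _, by simpa using N.d_mem _ _ hn⟩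
    have e : C.d (0, n) = (0, N.d n) := Prod.ext (map_zero R.d) rfl
    rw [e, C.sgn_of_mem hm, N.sgn_of_mem hm.2]
    simp
  have hyi : y ∈ C.polyGr i := by
    have := hb.2
    rwa [add_sub_cancel_left] at this
  have hz := C.polySgn_mem (C.lTensor_mem_polyGr (primitive K) hyi)
  have hndeg : ((0, n) : A × M) ∈ C.gr (i - 1) := ⟨Submodule.zero_mem _, hn⟩
  have hn2 : C.sgn (C.d (0, n)) ∈ C.gr i := C.sgn_mem (by simpa using C.d_mem _ _ hndeg)
  refine ⟨⟨_, ?_⟩, ?_, Subtype.ext key⟩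
  · have e0 : polyEval K (A × M) 0 (C.polySgn (LinearMap.lTensor (A × M) (primitive K) y) -
        C.sgn (C.d (0, n)) ⊗ₜ Polynomial.X) = 0 := by
      rw [map_sub, polySgn, polyEval_rTensor, polyEval_zero_primitive, map_zero, polyEval_tmul,
        Polynomial.eval_X, zero_smul, sub_zero]
    refine ⟨congrArg Prod.fst e0, congrArg Prod.snd e0, ?_⟩
    have hs : ∀ v : A × M, (C.sgn v).2 = N.sgn v.2 := fun v => by
      have := congrArg (polyEval K M 0) (snd_polySgn N (v ⊗ₜ (1 : K[X])))
      simpa [polySgn] using this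
    -- At t = 1 the M-component is ε of the integral of y minus ε(dn), which is zero by `hnb`; the
    -- term linear in t was chosen for this.
    rw [map_sub, polySgn, polyEval_rTensor, polyEval_tmul, Polynomial.eval_X, one_smul,
      Prod.snd_sub, hs, ← hnb, hsd, sub_self]
  · refine ⟨?_, ?_⟩
    · change _ ∈ C.polyGr (1 + (i - 1))
      rw [add_sub_cancel]
      exact Submodule.sub_mem _ hz (C.tmul_mem_polyGr hn2 _)
    · change _ ∈ C.polyGr (1 + (i - 1) - 1)
      rw [add_sub_cancel]
      exact C.tmul_mem_polyGr hndeg _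

theorem linearPartHom_cohomologyMap_surjective (i : ℤ) :
    Function.Surjective ((linearPartHom N).cohomologyMap i) := by
  refine (linearPartHom N).cohomologyMap_surjective i ?_
  rintro m ⟨hm, hd⟩
  change N.d m = 0 at hd
  replace hm : m ∈ N.gr i := by
    change m ∈ N.gr (-1 + (1 + i)) at hm
    rwa [neg_add_cancel_left] at hm
  -- The form m dt is closed since dm = 0, meets the boundary conditions since it has no function
  -- part, and integrates to m.
  have hb : (fiberDt (0, m) 1 : fiberSub K A M) ∈ ((fiberAlg R N).shift 1).cocycles i := by
    refine ⟨⟨Submodule.zero_mem _, ?_⟩, Subtype.ext ?_⟩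
    · change _ ∈ (R.semidirect N).polyGr (1 + i - 1)
      rw [add_sub_cancel_left]
      exact (R.semidirect N).tmul_mem_polyGr ⟨Submodule.zero_mem _, hm⟩ _
    · change (R.semidirect N).formsD (0, (0, m) ⊗ₜ 1) = 0
      have e : (R.semidirect N).d (0, m) = 0 := Prod.ext (map_zero R.d) hd
      simp [formsD, e]
  refine ⟨_, hb, ?_⟩
  change DGAlg.linearPart (iterIntegralMap N) (fiberDt (0, m) 1) = m
  rw [linearPart_iterIntegralMap, dtM_fiberDt, polyCoprim_tmul, polyEval_tmul,
    eval_zero_coprimitive]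
  have h : primitive K 1 = Polynomial.X := by
    have := primitive_derivative (K := K) Polynomial.X
    simpa using this
  simp [h]

theorem isAInfinityQuasiIso_iterIntegralMap :
    DGAlg.IsAInfinityQuasiIso (fiberAlg R N) (DGAlg.trivial (N.toDGVec.shift (-1)))
      (iterIntegralMap N) :=
  ⟨isAInfinityMorphism_iterIntegralMap N, linearPartHom N, rfl, fun i =>
    ⟨linearPartHom_cohomologyMap_injective N i, linearPartHom_cohomologyMap_surjective N i⟩⟩

end QuasiIso

end

theorem mainTheorem7 {K A M : Type*} [Field K] [CharZero K] [AddCommGroup A] [Module K A]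
    [AddCommGroup M] [Module K M] (R : DGAlg K A) (N : DGMod R M) :
    (∃! F : RedTensor K (fiberSub K A M) →ₗ[K] M, IsIterIntegralMap N F) ∧
      ∀ F : RedTensor K (fiberSub K A M) →ₗ[K] M, IsIterIntegralMap N F →
        DGAlg.IsAInfinityQuasiIso (fiberAlg R N) (DGAlg.trivial (N.toDGVec.shift (-1))) F := by
  refine ⟨⟨iterIntegralMap N, isIterIntegralMap_iterIntegralMap N,
    fun F hF => hF.unique (isIterIntegralMap_iterIntegralMap N)⟩, fun F hF => ?_⟩
  rw [hF.unique (isIterIntegralMap_iterIntegralMap N)]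
  exact isAInfinityQuasiIso_iterIntegralMap N
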